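/- Let $\Phi$ be the (reduced, finite) root system of a complex reductive group with maximal torus $\hat T$, inside the character lattice $X^*(\hat T)$ (that is, a reduced root datum), with a chosen base and positive roots $\Phi^+$. Let $W$ be the Weyl group, $l$ its length function, $\leqslant$ the Bruhat order, $q_w=q^{l(w)}$, and write $\mathbf z^\lambda$ for the value of a character $\lambda$ at $\mathbf z\in\hat T(\mathbb C)$ and $(w\mathbf z)^\lambda=\mathbf z^{w^{-1}\lambda}$. Let $\hat T^{\mathrm{reg}}$ be the set of $\mathbf z\in\hat T(\mathbb C)$ with $\mathbf z^\alpha\neq1$ for all $\alpha\in\Phi$. Let $\mathcal H$ be the Iwahori–Hecke algebra of $W$ over $\mathbb C[q,q^{-1}]$, generated by $T_w$ ($w\in W$) with $T_1=1$, $T_{w}T_{w'}=T_{ww'}$ if $l(ww')=l(w)+l(w')$, and $T_s^2=(q-1)T_s+q$ for simple reflections $s$. For a polynomial $f$ in $q$ let $\overline f(q)=f(q^{-1})$. Then $(T_w)_{w\in W}$ is a basis of $\mathcal H$, and the following hold. There is a unique family $\mu_{\mathbf z}(w)\in\mathcal H$ ($w\in W$, $\mathbf z\in\hat T^{\mathrm{reg}}$)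 with $\mu_{\mathbf z}(1)=1$, with $$\mu_{\mathbf z}(s)=q^{-1}T_s+(1-q^{-1})\frac{\mathbf z^\alpha}{1-\mathbf z^\alpha}$$ for the simple reflection $s=s_\alpha$ in each simple root $\alpha$, and with $\mu_{\mathbf z}(w_1w_2)=\mu_{\mathbf z}(w_2)\,\mu_{w_2\mathbf z}(w_1)$ whenever $l(w_1w_2)=l(w_1)+l(w_2)$. There are unique polynomials $r_{u,v}(\mathbf z)\in\mathbb C[q]$ ($u,v\in W$, $\mathbf z\in\hat T^{\mathrm{reg}}$) with $$\mu_{\mathbf z}(v)=\sum_{u\in W}q_u^{-1}\,\overline{r_{u,v}(\mathbf z)}\;T_{u^{-1}}\qquad(v\in W),$$ and unique polynomials $R_{u,v}\in\mathbb Z[q]$ (the Kazhdan–Lusztig $R$-polynomials) with $T_{v^{-1}}^{-1}=\sum_{u\in W}q_u^{-1}\,\overline{R_{u,v}}\,T_u$ for all $v\in W$. They have these properties: 1. The coefficients of $r_{u,v}(\mathbf z)$ are regular functions of $\mathbf z$ on $\hat T^{\mathrm{reg}}$, that is, they lie in the $\mathbb C$-algebra of functions generated by the $\mathbf z^\lambda$,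 $\lambda\in X^*(\hat T)$, and the $(1-\mathbf z^\alpha)^{-1}$, $\alpha\in\Phi$. 2. $r_{u,u}=1$, and $r_{u,v}=0$ unless $u\leqslant v$. 3. If $\mathbf z\to\infty$ in $\hat T^{\mathrm{reg}}$ in such a direction that $\mathbf z^\alpha\to\infty$ for all $\alpha\in\Phi^+$, then $r_{u,v}(\mathbf z)\to R_{u,v}$, both coefficientwise and for each fixed value $q\in\mathbb C$. 4. Let $s=s_\alpha$ be the simple reflection in a simple root $\alpha$, with $sv<v$, and let $\mathbf z\in\hat T^{\mathrm{reg}}$. If $su<u$, then $$r_{u,v}(\mathbf z)=\frac{1-q}{1-\mathbf z^{-v^{-1}\alpha}}\,r_{u,sv}(\mathbf z)+r_{su,sv}(\mathbf z).$$ If $su>u$, then $$r_{u,v}(\mathbf z)=(1-q)\frac{\mathbf z^{-v^{-1}\alpha}}{1-\mathbf z^{-v^{-1}\alpha}}\,r_{u,sv}(\mathbf z)+q\,r_{su,sv}(\mathbf z).$$ -/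

import Mathlib

open Polynomial LaurentPolynomial Filter Topology

noncomputable section

namespace DeformedR

variable {ι M N : Type*} [AddCommGroup M] [AddCommGroup N] {P : RootPairing ι ℤ M N}

/-! ### The Weyl group of a root datum with a base: length and Bruhat order -/

/-- The simple reflection attached to a simple root. -/
def simpleRefl (b : P.Base) (i : b.support) : P.weylGroup :=
  RootPairing.weylGroup.ofIdx P i

/-- The length of `w`: the least number of factors in an expression of `w` as a product of simple
reflections. -/
def length (b : P.Base) (w : P.weylGroup) : ℕ :=
  sInf {n | ∃ ω : List b.support, ω.length = n ∧ (ω.map (simpleRefl b)).prod = w}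

/-- The Bruhat order: `u ≤ v` if `v` is obtained from `u` by successive multiplications by
reflections in roots, each of which increases the length. -/
def BruhatLE (b : P.Base) : P.weylGroup → P.weylGroup → Prop :=
  Relation.ReflTransGen fun x y ↦
    ∃ i : ι, y = x * RootPairing.weylGroup.ofIdx P i ∧ length b x < length b y

/-- The strict Bruhat order. -/
def BruhatLT (b : P.Base) (u v : P.weylGroup) : Prop :=
  BruhatLE b u v ∧ u ≠ v

/-! ### The Iwahori-Hecke algebra over `ℂ[q, q⁻¹]`

Polynomials in `q` are elements of `ℂ[X]`, with `X` in the role of `q`; in `ℂ[T;T⁻¹]` the element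
`T n` is `q ^ n`. -/

/-- The defining relations of the Iwahori-Hecke algebra on generators `T_w`. -/
inductive HeckeRel (b : P.Base) :
    FreeAlgebra ℂ[T;T⁻¹] P.weylGroup → FreeAlgebra ℂ[T;T⁻¹] P.weylGroup → Prop
  | one : HeckeRel b (FreeAlgebra.ι _ 1) 1
  | mul (u v : P.weylGroup) (h : length b (u * v) = length b u + length b v) :
      HeckeRel b (FreeAlgebra.ι _ u * FreeAlgebra.ι _ v) (FreeAlgebra.ι _ (u * v))
  | quadratic (i : b.support) :
      HeckeRel b (FreeAlgebra.ι _ (simpleRefl b i) * FreeAlgebra.ι _ (simpleRefl b i))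
        ((T 1 - 1 : ℂ[T;T⁻¹]) • FreeAlgebra.ι _ (simpleRefl b i) + (T 1 : ℂ[T;T⁻¹]) • 1)

/-- The Iwahori-Hecke algebra: `T_1 = 1`, `T_u T_v = T_{uv}` if `l(uv) = l(u) + l(v)`, and
`T_s ^ 2 = (q - 1) T_s + q` for simple reflections `s`. -/
abbrev Hecke (b : P.Base) : Type _ := RingQuot (HeckeRel b)

/-- The element `T_w` of the Hecke algebra. -/
def heckeT (b : P.Base) (w : P.weylGroup) : Hecke b :=
  RingQuot.mkAlgHom ℂ[T;T⁻¹] (HeckeRel b) (FreeAlgebra.ι _ w)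

/-- The Laurent polynomial `f(q⁻¹)` obtained from a polynomial `f(q)`. -/
def bar (f : ℂ[X]) : ℂ[T;T⁻¹] :=
  LaurentPolynomial.invert (Polynomial.toLaurent f)

/-! ### The regular part of the dual torus -/

/-- The complex points of the torus whose group of rational characters is `M`. -/
abbrev DualTorus (M : Type*) [AddCommGroup M] : Type _ := Multiplicative M →* ℂˣ

variable (P) in
/-- The regular set of the torus: the `z` such that `z ^ α ≠ 1` for all roots `α`. -/
def RegTorus : Type _ :=
  {z : DualTorus M // ∀ i : ι, z (Multiplicative.ofAdd (P.root i)) ≠ 1}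

/-- The value `z ^ m` of the character `m` at `z`. -/
def RegTorus.pow (z : RegTorus P) (m : M) : ℂ :=
  ((z.1 (Multiplicative.ofAdd m) : ℂˣ) : ℂ)

/-- The action of the Weyl group on the regular set: `(w z) ^ m = z ^ (w⁻¹ m)`. -/
def RegTorus.act (w : P.weylGroup) (z : RegTorus P) : RegTorus P :=
  ⟨z.1.comp (AddMonoidHom.toMultiplicative (DistribSMul.toAddMonoidHom M w⁻¹)), fun i ↦ by
    have h := z.2 (P.weylGroupToPerm w⁻¹ i)
    rw [← P.weylGroup_apply_root] at h
    exact h⟩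

variable (P) in
/-- The ring of regular functions on the regular set of the torus (as an affine variety): the
algebra of functions generated by the characters `z ^ m` and the inverses of the functions
`1 - z ^ α` for the roots `α`. -/
def regularFunctions : Subalgebra ℂ (RegTorus P → ℂ) :=
  Algebra.adjoin ℂ
    (Set.range (fun (m : M) (z : RegTorus P) ↦ z.pow m) ∪
      Set.range (fun (i : ι) (z : RegTorus P) ↦ (1 - z.pow (P.root i))⁻¹))

/-- The filter on the regular set describing `z → ∞` in such a direction that `z ^ α → ∞` for all
positive roots `α`. -/
def atInfinity (b : P.Base) : Filter (RegTorus P) :=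
  ⨅ (i : ι) (_ : b.IsPos i),
    Filter.comap (fun z : RegTorus P ↦ z.pow (P.root i)) (Bornology.cobounded ℂ)

/-! ### The elements `μ_z(w)` -/

/-- The conditions that characterize the elements `μ_z(w)` of the Hecke algebra:
`μ_z(s) = q⁻¹ T_s + (1 - q⁻¹) z ^ α / (1 - z ^ α)` for the reflection `s` in a simple root `α`,
and `μ_z(w₁ w₂) = μ_z(w₂) μ_{w₂ z}(w₁)` if `l(w₁ w₂) = l(w₁) + l(w₂)`. -/
structure IsMu (b : P.Base) (μ : P.weylGroup → RegTorus P → Hecke b) : Prop where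
  one (z : RegTorus P) : μ 1 z = 1
  simple (i : b.support) (z : RegTorus P) :
    μ (simpleRefl b i) z = (T (-1) : ℂ[T;T⁻¹]) • heckeT b (simpleRefl b i) +
      algebraMap ℂ[T;T⁻¹] (Hecke b)
        ((1 - T (-1)) * LaurentPolynomial.C (z.pow (P.root i) / (1 - z.pow (P.root i))))
  mul (w₁ w₂ : P.weylGroup) (h : length b (w₁ * w₂) = length b w₁ + length b w₂)
    (z : RegTorus P) : μ (w₁ * w₂) z = μ w₂ z * μ w₁ (RegTorus.act w₂ z)

/-! ### Kazhdan-Lusztig `R`-polynomials and their deformations -/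

/-- `R` is the family of Kazhdan-Lusztig `R`-polynomials, defined by
`(T_{v⁻¹})⁻¹ = ∑ u, q ^ (-l(u)) R_{u,v}(q⁻¹) T_u`; here `B` is the basis of the `T_w`. -/
def IsKLR (b : P.Base) (B : Module.Basis P.weylGroup ℂ[T;T⁻¹] (Hecke b))
    (R : P.weylGroup → P.weylGroup → ℤ[X]) : Prop :=
  ∀ v : P.weylGroup, ∃ t : Hecke b, heckeT b v⁻¹ * t = 1 ∧ t * heckeT b v⁻¹ = 1 ∧
    ∀ u : P.weylGroup,
      B.repr t u = T (-(length b u : ℤ)) * bar ((R u v).map (Int.castRingHom ℂ))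

/-- `r` is the family of coefficients defined by
`μ_z(v) = ∑ u, q ^ (-l(u)) r_{u,v}(z)(q⁻¹) T_{u⁻¹}`; here `B` is the basis of the `T_w`. -/
def IsDeformedR (b : P.Base) (B : Module.Basis P.weylGroup ℂ[T;T⁻¹] (Hecke b))
    (μ : P.weylGroup → RegTorus P → Hecke b)
    (r : P.weylGroup → P.weylGroup → RegTorus P → ℂ[X]) : Prop :=
  ∀ (u v : P.weylGroup) (z : RegTorus P),
    B.repr (μ v z) u⁻¹ = T (-(length b u : ℤ)) * bar (r u v z)

end DeformedR

end

noncomputable section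

namespace DeformedR

variable {ι M N : Type*} [AddCommGroup M] [AddCommGroup N] {P : RootPairing ι ℤ M N}

open RootPairing

/-! ### The Weyl group acting on weights and roots -/

/-! A simple reflection permutes the positive roots other than its own (`isPos_simpleRefl_smul`).
This gives strong exchange, so the sign of `w • j` decides whether `w * s_j` is longer or shorter
than `w`. The length function, the lifting property of the Bruhat order and Matsumoto's theorem all
rest on this.

The `T_w` span because their span is stable under left multiplication. They are independent because
the free module on the Weyl group carries left operators that commute with the right ones; an
operator commuting with all right ones is determined by its value at `1`, so the Hecke relations
need only be checked there (`regularRep`).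

The rule for `μ_z` forces its value on any reduced word, which gives uniqueness. Existence means
independence of the reduced word. The twist by the torus is absorbed into operators on functions of
`z` (`muOp`), so Matsumoto's theorem reduces the claim to braid relations. These are Yang-Baxter
equations in types A1 × A1, A2, B2 and G2, and they follow from rational identities for `x / (1 -
x)` (`geomFrac_three`, `geomFrac_six`).

Reading off coefficients in `μ_z(sw) = μ_z(w) μ_{wz}(s)` gives the recursion for `r`, and with it
polynomiality, regularity, the Bruhat support and the diagonal values. Both `μ_z(s)` and `T_s⁻¹`
have the form `q⁻¹ T_s + (1 - q⁻¹) c`, with `c = z^α / (1 - z^α)` and `c = -1`. Hence `R` satisfies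
the recursion with `c = -1`. If `w < sw`, then `w⁻¹ α` is positive and `c` tends to `-1` at
infinity, so `r` tends to `R`. -/

lemma root_smul (w : P.weylGroup) (i : ι) : P.root (w • i) = w • P.root i :=
  (P.weylGroup_apply_root w i).symm

lemma weylGroup_ext {w w' : P.weylGroup} (h : ∀ m : M, w • m = w' • m) : w = w' := by
  refine Subtype.ext (RootPairing.Equiv.weightHom_injective P (LinearEquiv.ext h))

lemma ofIdx_smul' (i : ι) (m : M) :
    weylGroup.ofIdx P i • m = m - P.toLinearMap m (P.coroot i) • P.root i := by
  simp [P.reflection_apply]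

lemma ofIdx_mul_self (i : ι) : weylGroup.ofIdx P i * weylGroup.ofIdx P i = 1 :=
  weylGroup_ext fun m ↦ by simp [mul_smul]

lemma ofIdx_inv (i : ι) : (weylGroup.ofIdx P i)⁻¹ = weylGroup.ofIdx P i :=
  inv_eq_of_mul_eq_one_right (ofIdx_mul_self i)

lemma ofIdx_smul_idx (i j : ι) : weylGroup.ofIdx P i • j = P.reflectionPerm i j := rfl

lemma root_ofIdx_smul_self (i : ι) : P.root (weylGroup.ofIdx P i • i) = -P.root i := by
  simp [ofIdx_smul_idx]

lemma ofIdx_smul_eq_conj (w : P.weylGroup) (i : ι) :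
    weylGroup.ofIdx P (w • i) = w * weylGroup.ofIdx P i * w⁻¹ := by
  obtain ⟨g, hg⟩ := w
  induction hg using weylGroup.induction generalizing i with
  | mem j =>
    change weylGroup.ofIdx P (P.reflectionPerm j i) =
      weylGroup.ofIdx P j * weylGroup.ofIdx P i * (weylGroup.ofIdx P j)⁻¹
    rw [ofIdx_inv]
    refine weylGroup_ext fun m ↦ ?_
    simp [mul_smul, P.reflection_reflectionPerm]
  | one =>
    change weylGroup.ofIdx P ((1 : P.weylGroup) • i) = 1 * weylGroup.ofIdx P i * 1⁻¹
    simp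
  | mul x y hx hy ihx ihy =>
    have e : (⟨x * y, mul_mem hx hy⟩ : P.weylGroup) = ⟨x, hx⟩ * ⟨y, hy⟩ := rfl
    rw [e, mul_smul, ihx, ihy]
    group

lemma ofIdx_eq_of_root_eq_neg {i j : ι} (h : P.root j = -P.root i) :
    weylGroup.ofIdx P j = weylGroup.ofIdx P i := by
  have : j = weylGroup.ofIdx P i • i :=
    P.root.injective (by rw [h, root_ofIdx_smul_self])
  rw [this, ofIdx_smul_eq_conj, mul_assoc, mul_inv_cancel, mul_one]

/-! ### Positivity -/

variable {b : P.Base}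

lemma isPos_iff_not_of_root_eq_neg {i j : ι} (h : P.root j = -P.root i) :
    b.IsPos j ↔ ¬ b.IsPos i := by
  let := P.indexNeg
  have : j = -i := P.root.injective (by simp [h])
  rw [this, Base.IsPos.neg_iff_not]

lemma isPos_ofIdx_smul_self (i : ι) : b.IsPos (weylGroup.ofIdx P i • i) ↔ ¬ b.IsPos i :=
  isPos_iff_not_of_root_eq_neg (root_ofIdx_smul_self i)

lemma root_smul_smul_self (w : P.weylGroup) (i : ι) :
    P.root (w • weylGroup.ofIdx P i • i) = -P.root (w • i) := by
  rw [root_smul, root_ofIdx_smul_self, smul_neg, root_smul]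

lemma isPos_simple (i : b.support) : b.IsPos (i : ι) := Base.isPos_of_mem_support i.2

lemma simpleRefl_mul_self (i : b.support) : simpleRefl b i * simpleRefl b i = 1 :=
  ofIdx_mul_self _

@[simp] lemma simpleRefl_mul_cancel_left (i : b.support) (w : P.weylGroup) :
    simpleRefl b i * (simpleRefl b i * w) = w := by
  rw [← mul_assoc, simpleRefl_mul_self, one_mul]

@[simp] lemma simpleRefl_mul_cancel_right (w : P.weylGroup) (i : b.support) :
    w * simpleRefl b i * simpleRefl b i = w := by
  rw [mul_assoc, simpleRefl_mul_self, mul_one]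

@[simp] lemma simpleRefl_inv (i : b.support) : (simpleRefl b i)⁻¹ = simpleRefl b i :=
  ofIdx_inv _

/-- Brings left multiplication into the shape of a right multiplication by a reflection, as
`BruhatLE` requires. -/
lemma simpleRefl_mul_eq (i : b.support) (w : P.weylGroup) :
    simpleRefl b i * w = w * weylGroup.ofIdx P (w⁻¹ • (i : ι)) := by
  rw [ofIdx_smul_eq_conj, simpleRefl]; group

/-! ### Words in the simple reflections -/

variable (b) in
/-- The product of the simple reflections in a word. -/
def wordProd (ω : List b.support) : P.weylGroup := (ω.map (simpleRefl b)).prod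

@[simp] lemma wordProd_nil : wordProd b [] = 1 := rfl

@[simp] lemma wordProd_cons (i : b.support) (ω : List b.support) :
    wordProd b (i :: ω) = simpleRefl b i * wordProd b ω := by simp [wordProd]

@[simp] lemma wordProd_append (ω ω' : List b.support) :
    wordProd b (ω ++ ω') = wordProd b ω * wordProd b ω' := by simp [wordProd]

lemma wordProd_reverse (ω : List b.support) : wordProd b ω.reverse = (wordProd b ω)⁻¹ := by
  induction ω with
  | nil => simp
  | cons i ω ih => simp [ih]

lemma length_wordProd_le (ω : List b.support) : length b (wordProd b ω) ≤ ω.length :=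
  Nat.sInf_le ⟨ω, rfl, rfl⟩

@[simp] lemma length_one : length b 1 = 0 :=
  Nat.le_zero.1 (length_wordProd_le (b := b) [])

lemma length_simpleRefl_le (i : b.support) : length b (simpleRefl b i) ≤ 1 := by
  simpa using length_wordProd_le [i]

lemma BruhatLE.refl (u : P.weylGroup) : BruhatLE b u u := Relation.ReflTransGen.refl

lemma BruhatLE.trans {u v w : P.weylGroup} (h : BruhatLE b u v) (h' : BruhatLE b v w) :
    BruhatLE b u w := Relation.ReflTransGen.trans h h'

lemma BruhatLE.length_le {u v : P.weylGroup} (h : BruhatLE b u v) :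
    u = v ∨ length b u < length b v := by
  induction h with
  | refl => exact .inl rfl
  | tail _ h ih =>
    obtain ⟨i, rfl, h⟩ := h
    rcases ih with rfl | ih
    · exact .inr h
    · exact .inr (ih.trans h)

lemma BruhatLT.length_lt {u v : P.weylGroup} (h : BruhatLT b u v) : length b u < length b v :=
  h.1.length_le.resolve_left h.2

lemma bruhatLE_simpleRefl_mul {i : b.support} {w : P.weylGroup}
    (h : length b w < length b (simpleRefl b i * w)) : BruhatLE b w (simpleRefl b i * w) :=
  .single ⟨_, simpleRefl_mul_eq i w, h⟩

section
variable [Finite ι] [P.IsReduced]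

lemma isPos_simpleRefl_smul {i : b.support} {j : ι} (hj : b.IsPos j) (hij : j ≠ i) :
    b.IsPos (simpleRefl b i • j) :=
  hj.reflectionPerm i.2 hij

/-- The reflection is an involution, so the one-sided statement can be applied to the image of `j`;
excluding `-α_i` keeps that image away from `α_i`. -/
lemma isPos_simpleRefl_smul_iff {i : b.support} {j : ι} (hij : j ≠ i)
    (hij' : P.root j ≠ -P.root i) : b.IsPos (simpleRefl b i • j) ↔ b.IsPos j := by
  refine ⟨fun h ↦ ?_, fun h ↦ isPos_simpleRefl_smul h hij⟩
  have : simpleRefl b i • j ≠ i := by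
    intro h'
    apply hij'
    have e : j = simpleRefl b i • (i : ι) := by
      rw [← h', ← mul_smul, simpleRefl_mul_self, one_smul]
    rw [e]
    exact root_ofIdx_smul_self _
  simpa [← mul_smul, simpleRefl_mul_self] using isPos_simpleRefl_smul h this

lemma exists_wordProd_ofIdx {i : ι} (hi : b.IsPos i) :
    ∃ ω, wordProd b ω = weylGroup.ofIdx P i := by
  refine hi.induction_on_reflect (p := fun i ↦ ∃ ω, wordProd b ω = weylGroup.ofIdx P i)
    (fun j hj ↦ ⟨[⟨j, hj⟩], by simp [simpleRefl]⟩) ?_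
  rintro k j ⟨ω, hω⟩ hj
  refine ⟨⟨j, hj⟩ :: (ω ++ [⟨j, hj⟩]), ?_⟩
  have := ofIdx_smul_eq_conj (simpleRefl b ⟨j, hj⟩) k
  change weylGroup.ofIdx P (P.reflectionPerm j k) = _ at this
  simp [this, hω, mul_assoc]

variable (b) in
lemma exists_wordProd (w : P.weylGroup) : ∃ ω, wordProd b ω = w := by
  obtain ⟨g, hg⟩ := w
  induction hg using weylGroup.induction with
  | mem j =>
    by_cases h : b.IsPos j
    · exact exists_wordProd_ofIdx h
    · obtain ⟨ω, hω⟩ := exists_wordProd_ofIdx ((isPos_ofIdx_smul_self j).2 h)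
      exact ⟨ω, by rw [hω, ofIdx_eq_of_root_eq_neg (root_ofIdx_smul_self j)]; rfl⟩
  | one => exact ⟨[], rfl⟩
  | mul x y hx hy ihx ihy =>
    obtain ⟨ω, hω⟩ := ihx
    obtain ⟨ω', hω'⟩ := ihy
    exact ⟨ω ++ ω', by rw [wordProd_append, hω, hω']; rfl⟩

/-- Strong exchange: if `wordProd ω` makes a positive root negative, then multiplying by the
reflection in it amounts to deleting a letter. -/
lemma exists_wordProd_mul_ofIdx {j : ι} (hj : b.IsPos j) (ω : List b.support)
    (h : ¬ b.IsPos (wordProd b ω • j)) :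
    ∃ ω' : List b.support, ω'.length + 1 = ω.length ∧
      wordProd b ω' = wordProd b ω * weylGroup.ofIdx P j := by
  induction ω with
  | nil => exact absurd (by simpa using hj) h
  | cons i ω ih =>
    by_cases h' : b.IsPos (wordProd b ω • j)
    -- The sign changes only at the first letter, so the tail must carry `j` to the simple root `i`.
    -- The reflection in `j` then cancels that letter.
    · have hi : wordProd b ω • j = i := by
        by_contra hne
        rw [wordProd_cons, mul_smul] at h
        exact h (isPos_simpleRefl_smul h' hne)
      refine ⟨ω, rfl, ?_⟩
      have := ofIdx_smul_eq_conj (wordProd b ω) j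
      rw [hi] at this
      simp only [wordProd_cons, simpleRefl, this]
      rw [inv_mul_cancel_right, mul_assoc, ofIdx_mul_self, mul_one]
    · obtain ⟨ω', hl, hp⟩ := ih h'
      exact ⟨i :: ω', by simp [hl], by simp [hp, mul_assoc]⟩

/-! ### The length function -/

variable (b) in
lemma exists_reduced (w : P.weylGroup) : ∃ ω, wordProd b ω = w ∧ ω.length = length b w := by
  obtain ⟨ω, hω⟩ := exists_wordProd b w
  obtain ⟨ω', h, h'⟩ := Nat.sInf_mem
    (s := {n | ∃ ω : List b.support, ω.length = n ∧ (ω.map (simpleRefl b)).prod = w})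
    ⟨_, ω, rfl, hω⟩
  exact ⟨ω', h', h⟩

lemma length_inv_le (w : P.weylGroup) : length b w⁻¹ ≤ length b w := by
  obtain ⟨ω, rfl, h⟩ := exists_reduced b w
  rw [← h, ← wordProd_reverse, ← List.length_reverse]
  exact length_wordProd_le _

@[simp] lemma length_inv (w : P.weylGroup) : length b w⁻¹ = length b w :=
  le_antisymm (length_inv_le w) (by simpa using length_inv_le w⁻¹)

lemma length_mul_le (w w' : P.weylGroup) : length b (w * w') ≤ length b w + length b w' := by
  obtain ⟨ω, rfl, h⟩ := exists_reduced b w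
  obtain ⟨ω', rfl, h'⟩ := exists_reduced b w'
  rw [← h, ← h', ← wordProd_append, ← List.length_append]
  exact length_wordProd_le _

lemma length_mul_ofIdx_lt {w : P.weylGroup} {j : ι} (hj : b.IsPos j) (h : ¬ b.IsPos (w • j)) :
    length b (w * weylGroup.ofIdx P j) < length b w := by
  obtain ⟨ω, rfl, hω⟩ := exists_reduced b w
  obtain ⟨ω', hl, hp⟩ := exists_wordProd_mul_ofIdx hj ω h
  have := length_wordProd_le (b := b) ω'
  rw [hp] at this
  lia

/-- The element `w * s_j` makes `j` negative, so the previous lemma applies to it. -/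
lemma lt_length_mul_ofIdx {w : P.weylGroup} {j : ι} (hj : b.IsPos j) (h : b.IsPos (w • j)) :
    length b w < length b (w * weylGroup.ofIdx P j) := by
  have := length_mul_ofIdx_lt (w := w * weylGroup.ofIdx P j) hj (by
    rw [mul_smul, isPos_iff_not_of_root_eq_neg (root_smul_smul_self w j)]; exact fun h' ↦ h' h)
  rwa [mul_assoc, ofIdx_mul_self, mul_one] at this

lemma lt_length_mul_ofIdx_iff {w : P.weylGroup} {j : ι} (hj : b.IsPos j) :
    length b w < length b (w * weylGroup.ofIdx P j) ↔ b.IsPos (w • j) :=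
  ⟨fun h ↦ by_contra fun h' ↦ (length_mul_ofIdx_lt hj h').not_gt h, lt_length_mul_ofIdx hj⟩

lemma length_mul_simpleRefl_of_isPos {w : P.weylGroup} {i : b.support}
    (h : b.IsPos (w • (i : ι))) : length b (w * simpleRefl b i) = length b w + 1 := by
  have h₁ := lt_length_mul_ofIdx (isPos_simple i) h
  have h₂ := length_mul_le (b := b) w (simpleRefl b i)
  have h₃ := length_simpleRefl_le i
  simp only [simpleRefl] at *
  lia

lemma length_mul_simpleRefl_of_not_isPos {w : P.weylGroup} {i : b.support}
    (h : ¬ b.IsPos (w • (i : ι))) : length b (w * simpleRefl b i) + 1 = length b w := by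
  have := length_mul_simpleRefl_of_isPos (w := w * simpleRefl b i) (i := i) (by
    rw [mul_smul]
    exact (isPos_iff_not_of_root_eq_neg (root_smul_smul_self w i)).2 h)
  simpa using this.symm

lemma length_simpleRefl_mul_of_isPos {w : P.weylGroup} {i : b.support}
    (h : b.IsPos (w⁻¹ • (i : ι))) : length b (simpleRefl b i * w) = length b w + 1 := by
  rw [← length_inv, mul_inv_rev, simpleRefl_inv, length_mul_simpleRefl_of_isPos h, length_inv]

lemma length_simpleRefl_mul_of_not_isPos {w : P.weylGroup} {i : b.support}
    (h : ¬ b.IsPos (w⁻¹ • (i : ι))) : length b (simpleRefl b i * w) + 1 = length b w := by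
  rw [← length_inv, mul_inv_rev, simpleRefl_inv, length_mul_simpleRefl_of_not_isPos h, length_inv]

lemma length_mul_simpleRefl_lt_iff {w : P.weylGroup} {i : b.support} :
    length b (w * simpleRefl b i) < length b w ↔ ¬ b.IsPos (w • (i : ι)) := by
  by_cases h : b.IsPos (w • (i : ι))
  · simp [h, length_mul_simpleRefl_of_isPos h]
  · simp [h, ← length_mul_simpleRefl_of_not_isPos h]

lemma length_simpleRefl_mul_lt_iff {w : P.weylGroup} {i : b.support} :
    length b (simpleRefl b i * w) < length b w ↔ ¬ b.IsPos (w⁻¹ • (i : ι)) := by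
  by_cases h : b.IsPos (w⁻¹ • (i : ι))
  · simp [h, length_simpleRefl_mul_of_isPos h]
  · simp [h, ← length_simpleRefl_mul_of_not_isPos h]

@[simp] lemma length_simpleRefl (i : b.support) : length b (simpleRefl b i) = 1 := by
  simpa using length_mul_simpleRefl_of_isPos (w := 1) (i := i) (by simpa using isPos_simple i)

lemma length_simpleRefl_mul_eq_or (i : b.support) (w : P.weylGroup) :
    length b (simpleRefl b i * w) = length b w + 1 ∨
      length b (simpleRefl b i * w) + 1 = length b w := by
  by_cases h : b.IsPos (w⁻¹ • (i : ι))
  · exact .inl (length_simpleRefl_mul_of_isPos h)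
  · exact .inr (length_simpleRefl_mul_of_not_isPos h)

lemma exists_simpleRefl_mul_lt {w : P.weylGroup} (hw : w ≠ 1) :
    ∃ i : b.support, length b (simpleRefl b i * w) + 1 = length b w := by
  obtain ⟨ω, rfl, h⟩ := exists_reduced b w
  cases ω with
  | nil => simp at hw
  | cons i ω =>
    refine ⟨i, ?_⟩
    have h₁ := length_wordProd_le ω
    have h₂ := length_simpleRefl_mul_eq_or i (wordProd b (i :: ω))
    simp at *
    lia

lemma length_eq_zero_iff {w : P.weylGroup} : length b w = 0 ↔ w = 1 := by
  refine ⟨fun h ↦ ?_, fun h ↦ by simp [h]⟩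
  by_contra hw
  obtain ⟨i, hi⟩ := exists_simpleRefl_mul_lt (b := b) hw
  lia

variable (b) in
/-- Induction on the Weyl group along left multiplication by simple reflections that increase the
length. -/
@[elab_as_elim]
lemma weylGroup_induction {p : P.weylGroup → Prop} (one : p 1)
    (mul : ∀ (i : b.support) w, length b (simpleRefl b i * w) = length b w + 1 → p w →
      p (simpleRefl b i * w)) (w : P.weylGroup) : p w := by
  induction hn : length b w generalizing w with
  | zero => rw [length_eq_zero_iff.1 hn]; exact one
  | succ n ih =>
    obtain ⟨i, hi⟩ := exists_simpleRefl_mul_lt (b := b) (w := w) (by rintro rfl; simp at hn)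
    have := mul i (simpleRefl b i * w) (by simp [← hi]) (ih _ (by lia))
    simpa using this

/-! ### The Bruhat order -/

/-- The lifting property of the Bruhat order. -/
lemma BruhatLE.simpleRefl_mul {u v : P.weylGroup} (h : BruhatLE b u v) (i : b.support)
    (hv : length b v < length b (simpleRefl b i * v)) :
    BruhatLE b (simpleRefl b i * u) (simpleRefl b i * v) := by
  -- This disjunction does not need `hv`, so it can be proved by induction along a chain from `u` to
  -- `v`; `hv` is used only to pass from `v` to `s v`.
  suffices H : BruhatLE b (simpleRefl b i * u) v ∨
      BruhatLE b (simpleRefl b i * u) (simpleRefl b i * v) from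
    H.elim (fun h' ↦ h'.trans (bruhatLE_simpleRefl_mul hv)) id
  clear hv
  induction h using Relation.ReflTransGen.head_induction_on with
  | refl => exact .inr (.refl _)
  | @head x y hxy hy ih =>
    obtain ⟨j, rfl, hlt⟩ := hxy
    -- A root and its negative define the same reflection.
    wlog hj : b.IsPos j generalizing j
    · refine this (weylGroup.ofIdx P j • j) ?_ ?_ ?_ ((isPos_ofIdx_smul_self j).2 hj)
      all_goals rwa [ofIdx_eq_of_root_eq_neg (root_ofIdx_smul_self j)]
    have hpos := (lt_length_mul_ofIdx_iff hj).1 hlt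
    -- If `x • j` is the simple root, then `s x` is the next element of the chain itself. Otherwise
    -- `s` keeps `x • j` positive, and the step survives multiplication by `s`.
    by_cases hi : x • j = i
    · left
      have : simpleRefl b i * x = x * weylGroup.ofIdx P j := by
        rw [simpleRefl_mul_eq, ← hi, inv_smul_smul]
      rw [this]; exact hy
    · have : BruhatLE b (simpleRefl b i * x) (simpleRefl b i * (x * weylGroup.ofIdx P j)) := by
        refine .single ⟨j, by rw [mul_assoc], ?_⟩
        rw [← mul_assoc, lt_length_mul_ofIdx_iff hj, mul_smul]
        exact isPos_simpleRefl_smul hpos hi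
      exact ih.imp this.trans this.trans

end

/-! ### Multiplication in the Hecke algebra -/

@[simp] lemma heckeT_one : heckeT b 1 = 1 := by
  rw [heckeT, RingQuot.mkAlgHom_rel ℂ[T;T⁻¹] HeckeRel.one, map_one]

lemma heckeT_mul {u v : P.weylGroup} (h : length b (u * v) = length b u + length b v) :
    heckeT b u * heckeT b v = heckeT b (u * v) := by
  rw [heckeT, heckeT, ← map_mul, RingQuot.mkAlgHom_rel ℂ[T;T⁻¹] (HeckeRel.mul u v h), heckeT]

lemma heckeT_simpleRefl_sq (i : b.support) :
    heckeT b (simpleRefl b i) * heckeT b (simpleRefl b i) =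
      (T 1 - 1 : ℂ[T;T⁻¹]) • heckeT b (simpleRefl b i) + (T 1 : ℂ[T;T⁻¹]) • 1 := by
  rw [heckeT, ← map_mul, RingQuot.mkAlgHom_rel ℂ[T;T⁻¹] (HeckeRel.quadratic i), map_add, map_smul,
    map_smul, map_one]

section
variable [Finite ι] [P.IsReduced]

lemma heckeT_simpleRefl_mul {i : b.support} {w : P.weylGroup}
    (h : length b w < length b (simpleRefl b i * w)) :
    heckeT b (simpleRefl b i) * heckeT b w = heckeT b (simpleRefl b i * w) := by
  refine heckeT_mul ?_
  have := length_simpleRefl_mul_eq_or i w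
  rw [length_simpleRefl]; lia

lemma heckeT_simpleRefl_mul' {i : b.support} {w : P.weylGroup}
    (h : length b (simpleRefl b i * w) < length b w) :
    heckeT b (simpleRefl b i) * heckeT b w =
      (T 1 - 1 : ℂ[T;T⁻¹]) • heckeT b w + (T 1 : ℂ[T;T⁻¹]) • heckeT b (simpleRefl b i * w) := by
  obtain ⟨v, rfl⟩ : ∃ v, w = simpleRefl b i * v := ⟨simpleRefl b i * w, by simp⟩
  rw [simpleRefl_mul_cancel_left] at h ⊢
  rw [← heckeT_simpleRefl_mul h, ← mul_assoc, heckeT_simpleRefl_sq, add_mul, smul_mul_assoc,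
    smul_mul_assoc, one_mul]

lemma length_mul_simpleRefl_eq (i : b.support) (w : P.weylGroup) :
    length b (w * simpleRefl b i) = length b (simpleRefl b i * w⁻¹) := by
  rw [← length_inv, mul_inv_rev, simpleRefl_inv]

lemma heckeT_mul_simpleRefl {i : b.support} {w : P.weylGroup}
    (h : length b w < length b (w * simpleRefl b i)) :
    heckeT b w * heckeT b (simpleRefl b i) = heckeT b (w * simpleRefl b i) := by
  refine heckeT_mul ?_
  have := length_simpleRefl_mul_eq_or i w⁻¹
  rw [length_mul_simpleRefl_eq] at h ⊢
  rw [length_inv] at this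
  rw [length_simpleRefl]; lia

lemma heckeT_mul_simpleRefl' {i : b.support} {w : P.weylGroup}
    (h : length b (w * simpleRefl b i) < length b w) :
    heckeT b w * heckeT b (simpleRefl b i) =
      (T 1 - 1 : ℂ[T;T⁻¹]) • heckeT b w + (T 1 : ℂ[T;T⁻¹]) • heckeT b (w * simpleRefl b i) := by
  obtain ⟨v, rfl⟩ : ∃ v, w = v * simpleRefl b i := ⟨w * simpleRefl b i, by simp⟩
  rw [simpleRefl_mul_cancel_right] at h ⊢
  rw [← heckeT_mul_simpleRefl h, mul_assoc, heckeT_simpleRefl_sq, mul_add, mul_smul_comm,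
    mul_smul_comm, mul_one]

/-! ### The regular representation of the Hecke algebra -/

variable (b) in
/-- Left multiplication by `T_s` on the free module on the Weyl group. -/
def leftOp (i : b.support) : Module.End ℂ[T;T⁻¹] (P.weylGroup →₀ ℂ[T;T⁻¹]) :=
  Finsupp.linearCombination ℂ[T;T⁻¹] fun w ↦
    open Classical in
    if length b w < length b (simpleRefl b i * w) then Finsupp.single (simpleRefl b i * w) 1
    else (T 1 - 1 : ℂ[T;T⁻¹]) • Finsupp.single w 1 +
      (T 1 : ℂ[T;T⁻¹]) • Finsupp.single (simpleRefl b i * w) 1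

variable (b) in
/-- Right multiplication by `T_s` on the free module on the Weyl group. -/
def rightOp (i : b.support) : Module.End ℂ[T;T⁻¹] (P.weylGroup →₀ ℂ[T;T⁻¹]) :=
  Finsupp.linearCombination ℂ[T;T⁻¹] fun w ↦
    open Classical in
    if length b w < length b (w * simpleRefl b i) then Finsupp.single (w * simpleRefl b i) 1
    else (T 1 - 1 : ℂ[T;T⁻¹]) • Finsupp.single w 1 +
      (T 1 : ℂ[T;T⁻¹]) • Finsupp.single (w * simpleRefl b i) 1

lemma leftOp_single {i : b.support} {w : P.weylGroup} (h : b.IsPos (w⁻¹ • (i : ι))) :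
    leftOp b i (Finsupp.single w 1) = Finsupp.single (simpleRefl b i * w) 1 := by
  simp [leftOp, length_simpleRefl_mul_of_isPos h]

lemma leftOp_single' {i : b.support} {w : P.weylGroup} (h : ¬ b.IsPos (w⁻¹ • (i : ι))) :
    leftOp b i (Finsupp.single w 1) = (T 1 - 1 : ℂ[T;T⁻¹]) • Finsupp.single w 1 +
      (T 1 : ℂ[T;T⁻¹]) • Finsupp.single (simpleRefl b i * w) 1 := by
  rw [leftOp, Finsupp.linearCombination_single, one_smul,
    if_neg (length_simpleRefl_mul_lt_iff.2 h).not_gt]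

lemma rightOp_single {i : b.support} {w : P.weylGroup} (h : b.IsPos (w • (i : ι))) :
    rightOp b i (Finsupp.single w 1) = Finsupp.single (w * simpleRefl b i) 1 := by
  simp [rightOp, length_mul_simpleRefl_of_isPos h]

lemma rightOp_single' {i : b.support} {w : P.weylGroup} (h : ¬ b.IsPos (w • (i : ι))) :
    rightOp b i (Finsupp.single w 1) = (T 1 - 1 : ℂ[T;T⁻¹]) • Finsupp.single w 1 +
      (T 1 : ℂ[T;T⁻¹]) • Finsupp.single (w * simpleRefl b i) 1 := by
  rw [rightOp, Finsupp.linearCombination_single, one_smul,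
    if_neg (length_mul_simpleRefl_lt_iff.2 h).not_gt]

/-- The key exchange property: either left and right multiplication by simple reflections do not
influence each other's effect on the length, or they agree. -/
lemma simpleRefl_mul_eq_mul_simpleRefl_or (i j : b.support) (w : P.weylGroup) :
    simpleRefl b i * w = w * simpleRefl b j ∨
      (b.IsPos ((w * simpleRefl b j)⁻¹ • (i : ι)) ↔ b.IsPos (w⁻¹ • (i : ι))) ∧
      (b.IsPos ((simpleRefl b i * w) • (j : ι)) ↔ b.IsPos (w • (j : ι))) := by
  -- The two products agree when `w⁻¹ α_i = ±α_j`; for every other root the second reflection cannot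
  -- change the sign.
  by_cases h : w⁻¹ • (i : ι) = j
  · left; rw [simpleRefl_mul_eq, h]; rfl
  by_cases h' : P.root (w⁻¹ • (i : ι)) = -P.root j
  · left; rw [simpleRefl_mul_eq, ofIdx_eq_of_root_eq_neg h']; rfl
  right
  constructor
  · rw [mul_inv_rev, simpleRefl_inv, mul_smul]
    exact isPos_simpleRefl_smul_iff h h'
  · rw [mul_smul]
    refine isPos_simpleRefl_smul_iff (fun e ↦ h ?_) (fun e ↦ h' ?_)
    · rw [← e, inv_smul_smul]
    · rw [root_smul, inv_smul_eq_iff, smul_neg, ← root_smul, e, neg_neg]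

/-- This stands in for the associativity of `T_s T_w T_t`. Either `s w = w t`, and both operators
act on the same two basis vectors, or the left and right length changes are independent and the two
formulas commute term by term. -/
lemma leftOp_rightOp_comm (i j : b.support) : Commute (leftOp b i) (rightOp b j) := by
  refine Finsupp.lhom_ext' fun w ↦ LinearMap.ext_ring ?_
  change leftOp b i (rightOp b j (Finsupp.single w 1)) =
    rightOp b j (leftOp b i (Finsupp.single w 1))
  rcases simpleRefl_mul_eq_mul_simpleRefl_or i j w with h | ⟨h, h'⟩
  · have e : simpleRefl b i * w * simpleRefl b j = w := by rw [h, simpleRefl_mul_cancel_right]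
    have hl : b.IsPos (w⁻¹ • (i : ι)) ↔ b.IsPos (w • (j : ι)) := by
      rw [← not_iff_not, ← length_simpleRefl_mul_lt_iff, ← length_mul_simpleRefl_lt_iff, h]
    by_cases hi : b.IsPos (w⁻¹ • (i : ι))
    · rw [rightOp_single (hl.1 hi), leftOp_single hi, ← h, leftOp_single', h, rightOp_single']
      · simp [← h, e]
      · rw [← length_mul_simpleRefl_lt_iff, simpleRefl_mul_cancel_right,
          length_mul_simpleRefl_of_isPos (hl.1 hi)]
        lia
      · rw [← length_simpleRefl_mul_lt_iff, simpleRefl_mul_cancel_left,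
          length_simpleRefl_mul_of_isPos hi]
        lia
    · have hj : ¬ b.IsPos (w • (j : ι)) := fun h' ↦ hi (hl.2 h')
      rw [rightOp_single' hj, leftOp_single' hi, map_add, map_add, map_smul, map_smul, map_smul,
        map_smul, rightOp_single' hj, leftOp_single' hi, ← h, leftOp_single, h, rightOp_single]
      · simp [← h, e]
      · rw [← not_not (a := b.IsPos _), ← length_mul_simpleRefl_lt_iff,
          simpleRefl_mul_cancel_right, ← length_mul_simpleRefl_of_not_isPos hj]
        lia
      · rw [← not_not (a := b.IsPos _), ← length_simpleRefl_mul_lt_iff,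
          simpleRefl_mul_cancel_left, ← length_simpleRefl_mul_of_not_isPos hi]
        lia
  · by_cases hi : b.IsPos (w⁻¹ • (i : ι)) <;> by_cases hj : b.IsPos (w • (j : ι)) <;>
      simp only [hi, hj, iff_true, iff_false] at h h' <;>
      simp only [leftOp_single, leftOp_single', rightOp_single, rightOp_single', hi, hj, h, h',
        map_add, map_smul, mul_assoc, not_false_eq_true, smul_add]
    all_goals module

variable (b) in
/-- Left multiplication by the product of the `T_s` along a word. -/
def leftWord (ω : List b.support) : Module.End ℂ[T;T⁻¹] (P.weylGroup →₀ ℂ[T;T⁻¹]) :=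
  (ω.map (leftOp b)).prod

lemma leftWord_rightOp_comm (ω : List b.support) (j : b.support) :
    Commute (leftWord b ω) (rightOp b j) := by
  refine Commute.list_prod_left _ _ fun x hx ↦ ?_
  obtain ⟨i, -, rfl⟩ := List.mem_map.1 hx
  exact leftOp_rightOp_comm i j

lemma leftWord_single (ω : List b.support) (w : P.weylGroup)
    (h : length b (wordProd b ω * w) = ω.length + length b w) :
    leftWord b ω (Finsupp.single w 1) = Finsupp.single (wordProd b ω * w) 1 := by
  induction ω with
  | nil => simp [leftWord]
  | cons i ω ih =>
    have h₁ := length_mul_le (b := b) (wordProd b ω) w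
    have h₂ := length_wordProd_le ω
    have h₃ := length_simpleRefl_mul_eq_or i (wordProd b ω * w)
    rw [wordProd_cons, mul_assoc, List.length_cons] at h
    have h₄ := ih (by lia)
    simp only [leftWord, List.map_cons, List.prod_cons] at h₄ ⊢
    rw [Module.End.mul_apply, h₄, leftOp_single, wordProd_cons, mul_assoc]
    rw [← not_not (a := b.IsPos _), ← length_simpleRefl_mul_lt_iff]
    lia

/-- An operator that commutes with right multiplications is determined by its value at `1`. -/
lemma end_ext_of_commute {f g : Module.End ℂ[T;T⁻¹] (P.weylGroup →₀ ℂ[T;T⁻¹])}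
    (hf : ∀ j, Commute f (rightOp b j)) (hg : ∀ j, Commute g (rightOp b j))
    (h : f (Finsupp.single 1 1) = g (Finsupp.single 1 1)) : f = g := by
  refine Finsupp.lhom_ext' fun w ↦ LinearMap.ext_ring ?_
  change f (Finsupp.single w 1) = g (Finsupp.single w 1)
  -- Inversion turns induction by left multiplications into induction by right ones, which `f` and
  -- `g` respect.
  suffices ∀ w : P.weylGroup, f (Finsupp.single w⁻¹ 1) = g (Finsupp.single w⁻¹ 1) by
    simpa using this w⁻¹
  intro w
  induction w using weylGroup_induction b with
  | one => simpa using h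
  | mul i w hw ih =>
    have hpos : b.IsPos (w⁻¹ • (i : ι)) := by
      rw [← not_not (a := b.IsPos _), ← length_simpleRefl_mul_lt_iff]
      lia
    rw [mul_inv_rev, simpleRefl_inv, ← rightOp_single hpos, ← Module.End.mul_apply,
      ← Module.End.mul_apply, (hf i).eq, (hg i).eq, Module.End.mul_apply, ih, Module.End.mul_apply]

variable (b) in
/-- Left multiplication by `T_w`. -/
def leftMul (w : P.weylGroup) : Module.End ℂ[T;T⁻¹] (P.weylGroup →₀ ℂ[T;T⁻¹]) :=
  leftWord b (exists_reduced b w).choose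

lemma leftMul_rightOp_comm (w : P.weylGroup) (j : b.support) :
    Commute (leftMul b w) (rightOp b j) :=
  leftWord_rightOp_comm _ _

lemma leftMul_single {w v : P.weylGroup} (h : length b (w * v) = length b w + length b v) :
    leftMul b w (Finsupp.single v 1) = Finsupp.single (w * v) 1 := by
  obtain ⟨h₁, h₂⟩ := (exists_reduced b w).choose_spec
  rw [leftMul, leftWord_single, h₁]
  rw [h₁, h₂, h]

lemma leftMul_single_one (w : P.weylGroup) :
    leftMul b w (Finsupp.single 1 1) = Finsupp.single w 1 := by
  rw [leftMul_single] <;> simp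

variable (b) in
/-- The regular representation of the Hecke algebra. -/
def regularRep : Hecke b →ₐ[ℂ[T;T⁻¹]] Module.End ℂ[T;T⁻¹] (P.weylGroup →₀ ℂ[T;T⁻¹]) :=
  RingQuot.liftAlgHom ℂ[T;T⁻¹] ⟨FreeAlgebra.lift ℂ[T;T⁻¹] (leftMul b), by
    have key (i : b.support) : leftMul b (simpleRefl b i) = leftOp b i := by
      refine end_ext_of_commute (leftMul_rightOp_comm _) (leftOp_rightOp_comm i) ?_
      rw [leftMul_single_one, leftOp_single (by simpa using isPos_simple i), mul_one]
    -- Both sides of each relation commute with every `rightOp`, so it suffices to compare them at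
    -- the basis vector of `1`. This is also why the reduced word chosen in `leftMul` is immaterial.
    rintro _ _ (_ | ⟨u, v, h⟩ | i)
    · rw [FreeAlgebra.lift_ι_apply, map_one]
      refine end_ext_of_commute (leftMul_rightOp_comm _) (fun _ ↦ Commute.one_left _) ?_
      rw [leftMul_single_one, Module.End.one_apply]
    · rw [map_mul, FreeAlgebra.lift_ι_apply, FreeAlgebra.lift_ι_apply, FreeAlgebra.lift_ι_apply]
      refine end_ext_of_commute
        (fun j ↦ (leftMul_rightOp_comm _ j).mul_left (leftMul_rightOp_comm _ j))
        (leftMul_rightOp_comm _) ?_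
      rw [Module.End.mul_apply, leftMul_single_one, leftMul_single_one, leftMul_single h]
    · simp only [map_mul, map_add, map_smul, map_one, FreeAlgebra.lift_ι_apply, key]
      refine end_ext_of_commute (b := b)
        (fun j ↦ (leftOp_rightOp_comm _ j).mul_left (leftOp_rightOp_comm _ j))
        (fun j ↦ ((leftOp_rightOp_comm _ j).smul_left _).add_left
          ((Commute.one_left _).smul_left _)) ?_
      have hpos : b.IsPos ((1 : P.weylGroup)⁻¹ • (i : ι)) := by simpa using isPos_simple i
      have hneg : ¬ b.IsPos ((simpleRefl b i * 1)⁻¹ • (i : ι)) := by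
        rw [← length_simpleRefl_mul_lt_iff]
        simp [simpleRefl_mul_self]
      simp only [Module.End.mul_apply, leftOp_single hpos, leftOp_single' hneg, LinearMap.add_apply,
        LinearMap.smul_apply, Module.End.one_apply, simpleRefl_mul_cancel_left]⟩

lemma regularRep_heckeT (w : P.weylGroup) :
    regularRep b (heckeT b w) (Finsupp.single 1 1) = Finsupp.single w 1 := by
  rw [regularRep, heckeT, RingQuot.liftAlgHom_mkAlgHom_apply, FreeAlgebra.lift_ι_apply,
    leftMul_single_one]

/-- Acting on the basis vector of `1` in the regular representation sends the `T_w` to the standard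
basis. -/
lemma linearIndependent_heckeT : LinearIndependent ℂ[T;T⁻¹] (heckeT b) := by
  refine LinearIndependent.of_comp
    ((LinearMap.applyₗ (Finsupp.single 1 1)).comp (regularRep b).toLinearMap) ?_
  convert! Finsupp.linearIndependent_single_one ℂ[T;T⁻¹] P.weylGroup using 1
  ext1 w
  exact regularRep_heckeT w

lemma heckeT_mul_mem_span (u : P.weylGroup) {y : Hecke b}
    (hy : y ∈ Submodule.span ℂ[T;T⁻¹] (Set.range (heckeT b))) :
    heckeT b u * y ∈ Submodule.span ℂ[T;T⁻¹] (Set.range (heckeT b)) := by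
  have hT (w : P.weylGroup) : heckeT b w ∈ Submodule.span ℂ[T;T⁻¹] (Set.range (heckeT b)) :=
    Submodule.subset_span ⟨w, rfl⟩
  induction u using weylGroup_induction b generalizing y with
  | one => simpa using hy
  | mul i w hw ih =>
    rw [← heckeT_simpleRefl_mul (by lia), mul_assoc]
    replace ih := ih hy
    generalize heckeT b w * y = x at ih
    induction ih using Submodule.span_induction with
    | mem x hx =>
      obtain ⟨v, rfl⟩ := hx
      rcases length_simpleRefl_mul_eq_or i v with h | h
      · rw [heckeT_simpleRefl_mul (by lia)]
        exact hT _
      · rw [heckeT_simpleRefl_mul' (by lia)]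
        exact add_mem (Submodule.smul_mem _ _ (hT _)) (Submodule.smul_mem _ _ (hT _))
    | zero => simp
    | add x y _ _ hx hy => rw [mul_add]; exact add_mem hx hy
    | smul c x _ hx => rw [mul_smul_comm]; exact Submodule.smul_mem _ _ hx

/-- The span contains `1` and is stable under left multiplication by the generators, so it is
everything. -/
lemma span_heckeT : Submodule.span ℂ[T;T⁻¹] (Set.range (heckeT b)) = ⊤ := by
  refine Submodule.eq_top_iff'.2 fun x ↦ ?_
  suffices ∀ y ∈ Submodule.span ℂ[T;T⁻¹] (Set.range (heckeT b)),
      x * y ∈ Submodule.span ℂ[T;T⁻¹] (Set.range (heckeT b)) by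
    simpa using this 1 (Submodule.subset_span ⟨1, heckeT_one⟩)
  obtain ⟨x, rfl⟩ := RingQuot.mkAlgHom_surjective ℂ[T;T⁻¹] (HeckeRel b) x
  induction x using FreeAlgebra.induction with
  | grade0 c =>
    intro y hy
    rw [AlgHom.commutes, ← Algebra.smul_def]
    exact Submodule.smul_mem _ _ hy
  | grade1 w => exact fun y hy ↦ heckeT_mul_mem_span w hy
  | mul x₁ x₂ h₁ h₂ => exact fun y hy ↦ by rw [map_mul, mul_assoc]; exact h₁ _ (h₂ _ hy)
  | add x₁ x₂ h₁ h₂ =>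
    exact fun y hy ↦ by rw [map_add, add_mul]; exact add_mem (h₁ _ hy) (h₂ _ hy)

variable (b) in
/-- The basis of the Hecke algebra formed by the `T_w`. -/
def heckeBasis : Module.Basis P.weylGroup ℂ[T;T⁻¹] (Hecke b) :=
  .mk linearIndependent_heckeT span_heckeT.ge

@[simp] lemma heckeBasis_apply (w : P.weylGroup) : heckeBasis b w = heckeT b w := by
  simp [heckeBasis]

end

/-! ### Alternating words and rank two subsystems -/

/-- The word `i, j, i, j, …` of given length. -/
def altWord {α : Type*} (i j : α) : ℕ → List α
  | 0 => []
  | n + 1 => i :: altWord j i n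

/-- The letter at position `n` of the infinite word `i, j, i, j, …`. -/
def altLetter {α : Type*} (i j : α) : ℕ → α
  | 0 => i
  | n + 1 => altLetter j i n

lemma altWord_succ_eq_append {α : Type*} (i j : α) (n : ℕ) :
    altWord i j (n + 1) = altWord i j n ++ [altLetter i j n] := by
  induction n generalizing i j with
  | zero => rfl
  | succ n ih => rw [altWord, ih, altWord, altLetter, List.cons_append]

@[simp] lemma length_altWord {α : Type*} (i j : α) (n : ℕ) : (altWord i j n).length = n := by
  induction n generalizing i j with
  | zero => rfl
  | succ n ih => simp [altWord, ih]

/-- The coefficients of the roots `α`, `s_α β`, `s_α s_β α`, … with respect to simple roots `α`,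
`β`, where `A = -⟨β, α^∨⟩` and `B = -⟨α, β^∨⟩`. -/
def altCoeff (A B : ℤ) : ℕ → ℤ × ℤ
  | 0 => (1, 0)
  | n + 1 => ((altCoeff B A n).1 * A - (altCoeff B A n).2, (altCoeff B A n).1)

/-- The coefficients of the simple roots `α`, `β` in `s_α s_β s_α ⋯ x - x`, where `U = ⟨x, α^∨⟩`
and `V = ⟨x, β^∨⟩`. -/
def altShift (A B U V : ℤ) : ℕ → ℤ × ℤ
  | 0 => (0, 0)
  | n + 1 => ((altShift B A V U n).1 * A - (altShift B A V U n).2 - U, (altShift B A V U n).1)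

/-- The order of the product of two simple reflections. -/
def coxeterOrder (A B : ℤ) : ℕ :=
  -- The last branch is meant for `A * B = 3`, the only other product of a Cartan pair.
  if A * B = 0 then 2 else if A * B = 1 then 3 else if A * B = 2 then 4 else 6

/-- The possible Cartan integers, up to sign, of a pair of simple roots. -/
def IsCartanPair (A B : ℤ) : Prop :=
  A = 0 ∧ B = 0 ∨ A = 1 ∧ B = 1 ∨ A = 1 ∧ B = 2 ∨ A = 2 ∧ B = 1 ∨ A = 1 ∧ B = 3 ∨ A = 3 ∧ B = 1

lemma IsCartanPair.symm {A B : ℤ} (h : IsCartanPair A B) : IsCartanPair B A := by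
  unfold IsCartanPair at *; tauto

lemma coxeterOrder_comm (A B : ℤ) : coxeterOrder A B = coxeterOrder B A := by
  simp only [coxeterOrder, mul_comm]

/-- Nonnegativity is what makes alternating words reduced up to the braid length: each prefix keeps
the next simple root positive. -/
lemma IsCartanPair.altCoeff_nonneg {A B : ℤ} (h : IsCartanPair A B) {k : ℕ}
    (hk : k < coxeterOrder A B) : 0 ≤ (altCoeff A B k).1 ∧ 0 ≤ (altCoeff A B k).2 := by
  rcases h with ⟨rfl, rfl⟩ | ⟨rfl, rfl⟩ | ⟨rfl, rfl⟩ | ⟨rfl, rfl⟩ | ⟨rfl, rfl⟩ | ⟨rfl, rfl⟩ <;>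
    norm_num [coxeterOrder] at hk <;> interval_cases k <;> simp [altCoeff]

/-- The braid relation on weights, in coordinates; a finite check of six cases. -/
lemma IsCartanPair.altShift_swap {A B : ℤ} (h : IsCartanPair A B) (U V : ℤ) :
    altShift A B U V (coxeterOrder A B) = (altShift B A V U (coxeterOrder A B)).swap := by
  rcases h with ⟨rfl, rfl⟩ | ⟨rfl, rfl⟩ | ⟨rfl, rfl⟩ | ⟨rfl, rfl⟩ | ⟨rfl, rfl⟩ | ⟨rfl, rfl⟩ <;>
    (norm_num [coxeterOrder, altShift]; try constructor) <;> ring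

/-! ### Alternating words acting on weights and roots; Matsumoto's theorem -/

lemma simpleRefl_smul_root (i j : b.support) :
    simpleRefl b i • P.root j = P.root j + (-P.pairing j i) • P.root i := by
  rw [simpleRefl, ofIdx_smul', P.root_coroot_eq_pairing, neg_smul, sub_eq_add_neg]

lemma simpleRefl_smul_root_self (i : b.support) :
    simpleRefl b i • P.root i = -P.root i := by
  rw [← root_smul]
  exact root_ofIdx_smul_self _

lemma smul_zsmul_comm (w : P.weylGroup) (n : ℤ) (m : M) : w • n • m = n • w • m :=
  map_zsmul (DistribSMul.toAddMonoidHom M w) n m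

lemma altWord_smul_root (i j : b.support) (k : ℕ) :
    wordProd b (altWord i j k) • P.root (altLetter i j k : b.support) =
      (altCoeff (-P.pairing j i) (-P.pairing i j) k).1 • P.root i +
        (altCoeff (-P.pairing j i) (-P.pairing i j) k).2 • P.root j := by
  induction k generalizing i j with
  | zero => simp [altWord, altLetter, altCoeff]
  | succ k ih =>
    rw [altWord, altLetter, wordProd_cons, mul_smul, ih, smul_add, smul_zsmul_comm,
      smul_zsmul_comm, simpleRefl_smul_root, simpleRefl_smul_root_self, altCoeff]
    module

lemma altWord_smul (i j : b.support) (k : ℕ) (x : M) :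
    wordProd b (altWord i j k) • x = x +
      ((altShift (-P.pairing j i) (-P.pairing i j) (P.toLinearMap x (P.coroot i))
        (P.toLinearMap x (P.coroot j)) k).1 • P.root i +
      (altShift (-P.pairing j i) (-P.pairing i j) (P.toLinearMap x (P.coroot i))
        (P.toLinearMap x (P.coroot j)) k).2 • P.root j) := by
  induction k generalizing i j with
  | zero => simp [altWord, altShift]
  | succ k ih =>
    rw [altWord, wordProd_cons, mul_smul, ih, smul_add, smul_add, smul_zsmul_comm,
      smul_zsmul_comm, simpleRefl_smul_root, simpleRefl_smul_root_self, altShift, simpleRefl,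
      ofIdx_smul']
    module

/-- Height is additive, so the sign of a root can be read off from coordinates in two simple roots.
-/
lemma height_eq_of_root_eq {i j k : ι} {p q : ℤ} (h : P.root k = p • P.root i + q • P.root j) :
    b.height k = p * b.height i + q * b.height j := by
  obtain ⟨f, -, -, hf⟩ := b.exists_root_eq_sum_int i
  obtain ⟨g, -, -, hg⟩ := b.exists_root_eq_sum_int j
  have hk : P.root k = ∑ l ∈ b.support, (p * f l + q * g l) • P.root l := by
    rw [h, hf, hg, Finset.smul_sum, Finset.smul_sum, ← Finset.sum_add_distrib]
    exact Finset.sum_congr rfl fun l _ ↦ by rw [add_smul, mul_smul, mul_smul]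
  rw [Base.height_eq_sum hk, Base.height_eq_sum hf, Base.height_eq_sum hg,
    Finset.sum_add_distrib, Finset.mul_sum, Finset.mul_sum]

/-- The length of the longest alternating word in two simple reflections. -/
def braidLength (i j : b.support) : ℕ := coxeterOrder (-P.pairing j i) (-P.pairing i j)

lemma braidLength_comm (i j : b.support) : braidLength i j = braidLength j i :=
  coxeterOrder_comm _ _

lemma braidLength_pos (i j : b.support) : 0 < braidLength i j := by
  unfold braidLength coxeterOrder
  split_ifs <;> norm_num

section
variable [Finite ι] [P.IsReduced]

/-- The reduced crystallographic condition leaves finitely many pairs of Cartan integers, and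
distinct simple roots have nonpositive pairing. -/
lemma isCartanPair {i j : b.support} (hij : i ≠ j) :
    IsCartanPair (-P.pairing j i) (-P.pairing i j) := by
  have hij' : (i : ι) ≠ j := fun h ↦ hij (Subtype.ext h)
  have h₁ := P.pairingIn_pairingIn_mem_set_of_isCrystal_of_isRed' (i := i) (j := j)
    (fun h ↦ hij' (P.root.injective h)) (b.root_ne_neg_of_ne i.2 j.2 hij')
  have h₂ := b.pairingIn_le_zero_of_ne hij' i.2 j.2
  have e (k l : ι) : P.pairingIn ℤ k l = P.pairing k l := P.algebraMap_pairingIn ℤ k l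
  simp only [e, Set.mem_insert_iff, Set.mem_singleton_iff, Prod.mk.injEq] at h₁ h₂
  unfold IsCartanPair
  omega

lemma wordProd_altWord_braidLength {i j : b.support} (hij : i ≠ j) :
    wordProd b (altWord i j (braidLength i j)) = wordProd b (altWord j i (braidLength i j)) := by
  refine weylGroup_ext fun x ↦ ?_
  rw [altWord_smul, altWord_smul, braidLength, (isCartanPair hij).altShift_swap, Prod.fst_swap,
    Prod.snd_swap, add_comm (_ • P.root i)]

lemma isPos_altWord_smul {i j : b.support} (hij : i ≠ j) {k : ℕ} (hk : k < braidLength i j) :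
    b.IsPos (wordProd b (altWord i j k) • ((altLetter i j k : b.support) : ι)) := by
  have h := altWord_smul_root i j k
  rw [← root_smul] at h
  have := (isCartanPair hij).altCoeff_nonneg hk
  -- The weak inequality on the height suffices, since no root has height zero.
  rw [Base.isPos_iff', height_eq_of_root_eq h, Base.height_one_of_mem_support i.2,
    Base.height_one_of_mem_support j.2]
  lia

lemma not_isPos_smul_altWord_smul {i j : b.support} (hij : i ≠ j) {k : ℕ}
    (hk : k < braidLength i j) {w : P.weylGroup} (hi : ¬ b.IsPos (w • (i : ι)))
    (hj : ¬ b.IsPos (w • (j : ι))) :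
    ¬ b.IsPos (w • wordProd b (altWord i j k) • ((altLetter i j k : b.support) : ι)) := by
  have h := congr_arg (w • ·) (altWord_smul_root i j k)
  simp only [smul_add, smul_zsmul_comm, ← root_smul] at h
  have := (isCartanPair hij).altCoeff_nonneg hk
  rw [Base.isPos_iff, height_eq_of_root_eq h]
  rw [Base.isPos_iff, not_lt] at hi hj
  linarith [mul_nonpos_of_nonneg_of_nonpos this.1 hi, mul_nonpos_of_nonneg_of_nonpos this.2 hj]

lemma length_wordProd_altWord {i j : b.support} (hij : i ≠ j) {k : ℕ} (hk : k ≤ braidLength i j) :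
    length b (wordProd b (altWord i j k)) = k := by
  induction k with
  | zero => simp [altWord]
  | succ k ih =>
    rw [altWord_succ_eq_append, wordProd_append, wordProd_cons, wordProd_nil, mul_one,
      length_mul_simpleRefl_of_isPos (isPos_altWord_smul hij hk), ih (by lia)]

/-- When both reflections are left descents, `w⁻¹` makes both simple roots negative, hence also
every nonnegative combination of them that is a root. So each letter stripped from the left lowers
the length by one. -/
lemma length_altWord_inv_mul {i j : b.support} (hij : i ≠ j) {k : ℕ} (hk : k ≤ braidLength i j)
    {w : P.weylGroup} (hi : length b (simpleRefl b i * w) < length b w)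
    (hj : length b (simpleRefl b j * w) < length b w) :
    length b ((wordProd b (altWord i j k))⁻¹ * w) + k = length b w := by
  induction k with
  | zero => simp [altWord]
  | succ k ih =>
    rw [length_simpleRefl_mul_lt_iff] at hi hj
    have := length_simpleRefl_mul_of_not_isPos (i := altLetter i j k)
      (w := (wordProd b (altWord i j k))⁻¹ * w) (by
        rw [mul_inv_rev, inv_inv, mul_smul]
        exact not_isPos_smul_altWord_smul hij hk hi hj)
    rw [altWord_succ_eq_append, wordProd_append, wordProd_cons, wordProd_nil, mul_one,
      mul_inv_rev, simpleRefl_inv, mul_assoc]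
    have := ih (by lia)
    lia

/-- Matsumoto's theorem: if `f` satisfies the braid relations, then its product along a reduced
word depends only on the Weyl group element. -/
theorem prod_map_eq_of_reduced {G : Type*} [Monoid G] {f : b.support → G}
    (hf : ∀ i j, i ≠ j → ((altWord i j (braidLength i j)).map f).prod =
      ((altWord j i (braidLength i j)).map f).prod)
    {ω ω' : List b.support} (hω : length b (wordProd b ω) = ω.length)
    (hω' : length b (wordProd b ω') = ω'.length) (h : wordProd b ω = wordProd b ω') :
    (ω.map f).prod = (ω'.map f).prod := by
  induction hn : ω.length generalizing ω ω' with
  | zero =>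
    rw [List.length_eq_zero_iff.1 hn] at hω h ⊢
    rw [← h, hω, List.length_nil, eq_comm, List.length_eq_zero_iff] at hω'
    rw [hω']
  | succ n ih =>
    have tail {i : b.support} {l : List b.support}
        (hl : length b (wordProd b (i :: l)) = (i :: l).length) :
        length b (wordProd b l) = l.length := by
      have h₁ := length_wordProd_le l
      have h₂ := length_simpleRefl_mul_eq_or i (wordProd b l)
      simp only [wordProd_cons, List.length_cons] at hl
      lia
    have descent {i : b.support} {l : List b.support}
        (hl : length b (wordProd b (i :: l)) = (i :: l).length) :
        length b (simpleRefl b i * wordProd b (i :: l)) < length b (wordProd b (i :: l)) := by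
      rw [hl, wordProd_cons, simpleRefl_mul_cancel_left, tail hl]
      simp
    have hn' : ω'.length = n + 1 := by rw [← hω', ← h, hω, hn]
    obtain ⟨i, ω, rfl⟩ := List.exists_cons_of_length_eq_add_one hn
    obtain ⟨j, ω', rfl⟩ := List.exists_cons_of_length_eq_add_one hn'
    have same {i : b.support} {l l' : List b.support} (hl : (i :: l).length = n + 1)
        (h₁ : length b (wordProd b (i :: l)) = (i :: l).length)
        (h₂ : length b (wordProd b (i :: l')) = (i :: l').length)
        (h₃ : wordProd b (i :: l) = wordProd b (i :: l')) :
        ((i :: l).map f).prod = ((i :: l').map f).prod := by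
      simp only [List.map_cons, List.prod_cons]
      rw [ih (tail h₁) (tail h₂) (by simpa using h₃) (by simpa using hl)]
    by_cases hij : i = j
    · subst hij
      exact same hn hω hω' h
    -- A word starting with `i` whose element also has left descent `j` may be replaced by the
    -- longest alternating word followed by any reduced word for the rest. Both words start with
    -- `i`, so `same` compares them.
    have key {i j : b.support} {l : List b.support} (hij : i ≠ j) (hl : (i :: l).length = n + 1)
        (h₁ : length b (wordProd b (i :: l)) = (i :: l).length)
        (h₂ : length b (simpleRefl b j * wordProd b (i :: l)) < length b (wordProd b (i :: l)))
        {l' : List b.support}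
        (hl' : wordProd b l' = (wordProd b (altWord i j (braidLength i j)))⁻¹ * wordProd b (i :: l))
        (hl'' : l'.length = length b (wordProd b l')) :
        ((i :: l).map f).prod = ((altWord i j (braidLength i j) ++ l').map f).prod := by
      have h₃ := length_altWord_inv_mul hij le_rfl (descent h₁) h₂
      rw [← hl', ← hl''] at h₃
      have h₄ : wordProd b (i :: l) = wordProd b (altWord i j (braidLength i j) ++ l') := by
        rw [wordProd_append, hl', mul_inv_cancel_left]
      have h₅ : length b (wordProd b (altWord i j (braidLength i j) ++ l')) =
          (altWord i j (braidLength i j) ++ l').length := by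
        rw [← h₄, ← h₃, List.length_append, length_altWord, add_comm]
      obtain ⟨m, hm⟩ := Nat.exists_eq_succ_of_ne_zero (braidLength_pos i j).ne'
      rw [hm, altWord, List.cons_append] at h₄ h₅ ⊢
      exact same hl h₁ h₅ h₄
    -- One remainder `l'` serves both words, because the two alternating words have the same
    -- product. The two replacements then differ by a single braid move.
    obtain ⟨l', hl', hl''⟩ := exists_reduced b
      ((wordProd b (altWord i j (braidLength i j)))⁻¹ * wordProd b (i :: ω))
    rw [← hl'] at hl''
    rw [key hij hn hω (by rw [h]; exact descent hω') hl' hl'',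
      key (Ne.symm hij) hn' hω' (by rw [← h]; exact descent hω) (l' := l')
        (by rw [hl', braidLength_comm j i, wordProd_altWord_braidLength hij, h]) hl'',
      List.map_append, List.map_append, List.prod_append, List.prod_append, hf i j hij,
      braidLength_comm j i]

end

/-! ### The Yang-Baxter equation in rank two -/

section
variable {R H : Type*} [CommRing R] [Ring H] [Algebra R H] {e : R} {t s : H}

lemma yangBaxter_two (hts : t * s = s * t) (n₁ n₂ : R) :
    (t + (e * n₁) • 1) * (s + (e * n₂) • 1) = (s + (e * n₂) • 1) * (t + (e * n₁) • 1) := by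
  simp only [mul_add, add_mul, smul_mul_assoc, mul_smul_comm, mul_one, one_mul, hts]
  match_scalars <;> ring

/-- In the application `t`, `s` are `q⁻¹ T_s` for two simple reflections and `e = 1 - q⁻¹`. After
expansion into alternating words, each coefficient either agrees identically or differs by `±e ^ 2`
times the condition `h`. -/
lemma yangBaxter_three (ht : t * t = e • t + (1 - e) • 1) (hs : s * s = e • s + (1 - e) • 1)
    (hts : t * (s * t) = s * (t * s)) {n₁ n₂ n₃ : R} (h : n₁ * n₃ = n₁ * n₂ + n₂ + n₂ * n₃) :
    (t + (e * n₁) • 1) * ((s + (e * n₂) • 1) * (t + (e * n₃) • 1)) =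
      (s + (e * n₃) • 1) * ((t + (e * n₂) • 1) * (s + (e * n₁) • 1)) := by
  simp only [mul_add, add_mul, smul_mul_assoc, mul_smul_comm, mul_one, one_mul, ht, hs, hts,
    smul_add, smul_smul]
  match_scalars
  all_goals first
    | ring1
    | linear_combination -e ^ 2 * h
    | linear_combination e ^ 2 * h

lemma yangBaxter_four (ht : t * t = e • t + (1 - e) • 1) (hs : s * s = e • s + (1 - e) • 1)
    (hts : t * (s * (t * s)) = s * (t * (s * t))) {n₁ n₂ n₃ n₄ : R}
    (h : n₁ * n₄ = n₁ * n₂ + n₂ + n₂ * n₃ + n₃ + n₃ * n₄) :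
    (t + (e * n₁) • 1) * ((s + (e * n₂) • 1) * ((t + (e * n₃) • 1) * (s + (e * n₄) • 1))) =
      (s + (e * n₄) • 1) * ((t + (e * n₃) • 1) * ((s + (e * n₂) • 1) * (t + (e * n₁) • 1))) := by
  have ht' (x : H) : t * (t * x) = e • (t * x) + (1 - e) • x := by
    rw [← mul_assoc, ht, add_mul, smul_mul_assoc, smul_mul_assoc, one_mul]
  have hs' (x : H) : s * (s * x) = e • (s * x) + (1 - e) • x := by
    rw [← mul_assoc, hs, add_mul, smul_mul_assoc, smul_mul_assoc, one_mul]
  simp only [mul_add, add_mul, smul_mul_assoc, mul_smul_comm, mul_one, one_mul, ht, hs, ht', hs',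
    hts, smul_add, smul_smul]
  match_scalars
  all_goals first
    | ring1
    | linear_combination -e ^ 2 * h
    | linear_combination e ^ 2 * h

/-- Same expansion; the remaining differences are multiples of `h₁` or combinations of `h₂` and
`h₃`. -/
lemma yangBaxter_six (ht : t * t = e • t + (1 - e) • 1) (hs : s * s = e • s + (1 - e) • 1)
    (hts : t * (s * (t * (s * (t * s)))) = s * (t * (s * (t * (s * t))))) {n₁ n₂ n₃ n₄ n₅ n₆ : R}
    (h₁ : n₁ * n₆ = n₁ * n₂ + n₂ + n₂ * n₃ + n₃ + n₃ * n₄ + n₄ + n₄ * n₅ + n₅ + n₅ * n₆)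
    (h₂ : n₁ * n₅ + n₂ * n₆ = n₁ * n₃ + n₂ * n₄ + n₃ + n₃ * n₅ + n₄ + n₄ * n₆)
    (h₃ : n₁ * n₂ * n₃ * n₆ + n₁ * n₃ * n₄ * n₆ + n₁ * n₃ * n₆ + n₁ * n₄ * n₅ * n₆ + n₁ * n₄ * n₆ =
      n₁ * n₂ * n₃ * n₄ + n₁ * n₂ * n₄ + n₁ * n₂ * n₄ * n₅ + n₁ * n₂ * n₅ + n₁ * n₂ * n₅ * n₆ +
        n₂ * n₃ * n₄ + n₂ * n₃ * n₄ * n₅ + n₂ * n₃ * n₅ + n₂ * n₃ * n₅ * n₆ + n₂ * n₄ +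
        n₂ * n₄ * n₅ + n₂ * n₅ + n₂ * n₅ * n₆ + n₃ * n₄ * n₅ + n₃ * n₄ * n₅ * n₆ + n₃ * n₅ +
        n₃ * n₅ * n₆) :
    (t + (e * n₁) • 1) * ((s + (e * n₂) • 1) * ((t + (e * n₃) • 1) * ((s + (e * n₄) • 1) *
      ((t + (e * n₅) • 1) * (s + (e * n₆) • 1))))) =
    (s + (e * n₆) • 1) * ((t + (e * n₅) • 1) * ((s + (e * n₄) • 1) * ((t + (e * n₃) • 1) *
      ((s + (e * n₂) • 1) * (t + (e * n₁) • 1))))) := by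
  have ht' (x : H) : t * (t * x) = e • (t * x) + (1 - e) • x := by
    rw [← mul_assoc, ht, add_mul, smul_mul_assoc, smul_mul_assoc, one_mul]
  have hs' (x : H) : s * (s * x) = e • (s * x) + (1 - e) • x := by
    rw [← mul_assoc, hs, add_mul, smul_mul_assoc, smul_mul_assoc, one_mul]
  simp only [mul_add, add_mul, smul_mul_assoc, mul_smul_comm, mul_one, one_mul, ht, hs, ht', hs',
    hts, smul_add, smul_smul]
  match_scalars
  all_goals first
    | ring1
    | linear_combination -e ^ 2 * h₁
    | linear_combination e ^ 2 * h₁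
    | linear_combination (e ^ 3 - e ^ 2) * h₂ - e ^ 4 * h₃
    | linear_combination (e ^ 2 - e ^ 3) * h₂ + e ^ 4 * h₃

end

/-- The function `x ↦ x / (1 - x)`. -/
def geomFrac (x : ℂ) : ℂ := x / (1 - x)

lemma geomFrac_three {x y : ℂ} (hx : x ≠ 1) (hy : y ≠ 1) (hxy : x * y ≠ 1) :
    geomFrac x * geomFrac y = geomFrac x * geomFrac (x * y) + geomFrac (x * y) +
      geomFrac (x * y) * geomFrac y := by
  have h₁ : 1 - x ≠ 0 := sub_ne_zero.2 hx.symm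
  have h₂ : 1 - y ≠ 0 := sub_ne_zero.2 hy.symm
  have h₃ : 1 - x * y ≠ 0 := sub_ne_zero.2 hxy.symm
  unfold geomFrac
  field_simp
  ring

/-- Sum of the three-term identities for the pairs `(x, y)` and `(x * y, y)`. -/
lemma geomFrac_four {x y : ℂ} (hx : x ≠ 1) (hxy : x * y ≠ 1) (hxy' : x * y ^ 2 ≠ 1) (hy : y ≠ 1) :
    geomFrac x * geomFrac y = geomFrac x * geomFrac (x * y) + geomFrac (x * y) +
      geomFrac (x * y) * geomFrac (x * y ^ 2) + geomFrac (x * y ^ 2) +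
      geomFrac (x * y ^ 2) * geomFrac y := by
  have h₁ := geomFrac_three hx hy hxy
  have h₂ := geomFrac_three hxy hy (by rwa [mul_assoc, ← sq])
  rw [mul_assoc, ← sq] at h₂
  linear_combination h₁ + h₂

/-- The arguments are the characters of the positive roots of G2, in the order met along an
alternating word. The first two identities are sums of three-term identities over pairs of roots
whose sum is a root; the third is verified by clearing denominators. -/
lemma geomFrac_six {x y : ℂ} (h₁ : x ≠ 1) (h₂ : x * y ≠ 1) (h₃ : x ^ 2 * y ^ 3 ≠ 1)
    (h₄ : x * y ^ 2 ≠ 1) (h₅ : x * y ^ 3 ≠ 1) (h₆ : y ≠ 1) {n₁ n₂ n₃ n₄ n₅ n₆ : ℂ}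
    (e₁ : n₁ = geomFrac x) (e₂ : n₂ = geomFrac (x * y)) (e₃ : n₃ = geomFrac (x ^ 2 * y ^ 3))
    (e₄ : n₄ = geomFrac (x * y ^ 2)) (e₅ : n₅ = geomFrac (x * y ^ 3)) (e₆ : n₆ = geomFrac y) :
    (n₁ * n₆ = n₁ * n₂ + n₂ + n₂ * n₃ + n₃ + n₃ * n₄ + n₄ + n₄ * n₅ + n₅ + n₅ * n₆) ∧
    (n₁ * n₅ + n₂ * n₆ = n₁ * n₃ + n₂ * n₄ + n₃ + n₃ * n₅ + n₄ + n₄ * n₆) ∧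
    (n₁ * n₂ * n₃ * n₆ + n₁ * n₃ * n₄ * n₆ + n₁ * n₃ * n₆ + n₁ * n₄ * n₅ * n₆ + n₁ * n₄ * n₆ =
      n₁ * n₂ * n₃ * n₄ + n₁ * n₂ * n₄ + n₁ * n₂ * n₄ * n₅ + n₁ * n₂ * n₅ + n₁ * n₂ * n₅ * n₆ +
        n₂ * n₃ * n₄ + n₂ * n₃ * n₄ * n₅ + n₂ * n₃ * n₅ + n₂ * n₃ * n₅ * n₆ + n₂ * n₄ +
        n₂ * n₄ * n₅ + n₂ * n₅ + n₂ * n₅ * n₆ + n₃ * n₄ * n₅ + n₃ * n₄ * n₅ * n₆ + n₃ * n₅ +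
        n₃ * n₅ * n₆) := by
  have h₁₆ := geomFrac_three h₁ h₆ h₂
  have h₂₆ := geomFrac_three h₂ h₆ (by rwa [mul_assoc, ← sq])
  have h₄₆ := geomFrac_three h₄ h₆ (by rwa [mul_assoc, ← pow_succ])
  have h₁₅ := geomFrac_three h₁ h₅ (by rwa [← mul_assoc, ← sq])
  have h₂₄ := geomFrac_three h₂ h₄ (by convert h₃ using 1; ring)
  rw [mul_assoc, ← sq, ← e₂, ← e₄, ← e₆] at h₂₆
  rw [mul_assoc, ← pow_succ, ← e₄, ← e₅, ← e₆] at h₄₆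
  rw [← mul_assoc, ← sq, ← e₁, ← e₅, ← e₃] at h₁₅
  rw [show x * y * (x * y ^ 2) = x ^ 2 * y ^ 3 by ring, ← e₂, ← e₃, ← e₄] at h₂₄
  rw [← e₁, ← e₂, ← e₆] at h₁₆
  refine ⟨by linear_combination h₁₆ + h₂₆ + h₄₆ + h₂₄, by linear_combination h₁₅ + h₂₆, ?_⟩
  have h₁' : 1 - x ≠ 0 := sub_ne_zero.2 h₁.symm
  have h₂' : 1 - x * y ≠ 0 := sub_ne_zero.2 h₂.symm
  have h₃' : 1 - x ^ 2 * y ^ 3 ≠ 0 := sub_ne_zero.2 h₃.symm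
  have h₄' : 1 - x * y ^ 2 ≠ 0 := sub_ne_zero.2 h₄.symm
  have h₅' : 1 - x * y ^ 3 ≠ 0 := sub_ne_zero.2 h₅.symm
  have h₆' : 1 - y ≠ 0 := sub_ne_zero.2 h₆.symm
  rw [e₁, e₂, e₃, e₄, e₅, e₆]
  unfold geomFrac
  field_simp
  ring

/-! ### The action of the Weyl group on the regular torus -/

lemma RegTorus.pow_act (w : P.weylGroup) (z : RegTorus P) (m : M) :
    (RegTorus.act w z).pow m = z.pow (w⁻¹ • m) := rfl

lemma RegTorus.act_act (w w' : P.weylGroup) (z : RegTorus P) :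
    RegTorus.act w (RegTorus.act w' z) = RegTorus.act (w * w') z := by
  refine Subtype.ext (MonoidHom.ext fun m ↦ Units.ext ?_)
  change z.pow (w'⁻¹ • w⁻¹ • m.toAdd) = z.pow ((w * w')⁻¹ • m.toAdd)
  rw [mul_inv_rev, mul_smul]

@[simp] lemma RegTorus.act_one (z : RegTorus P) : RegTorus.act 1 z = z := by
  refine Subtype.ext (MonoidHom.ext fun m ↦ Units.ext ?_)
  change z.pow ((1 : P.weylGroup)⁻¹ • m.toAdd) = z.pow m.toAdd
  rw [inv_one, one_smul]

lemma RegTorus.pow_add (z : RegTorus P) (m n : M) : z.pow (m + n) = z.pow m * z.pow n := by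
  simp [RegTorus.pow, ofAdd_add]

lemma RegTorus.pow_zsmul (z : RegTorus P) (n : ℤ) (m : M) : z.pow (n • m) = z.pow m ^ n := by
  simp [RegTorus.pow, ofAdd_zsmul]

lemma RegTorus.pow_root_ne_one (z : RegTorus P) (i : ι) : z.pow (P.root i) ≠ 1 :=
  fun h ↦ z.2 i (Units.ext h)

/-! ### The elements `μ_z(w)` along words -/

variable (b) in
/-- The normalized generator `q⁻¹ T_s`. -/
def heckeNorm (i : b.support) : Hecke b := (T (-1) : ℂ[T;T⁻¹]) • heckeT b (simpleRefl b i)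

lemma heckeNorm_sq (i : b.support) :
    heckeNorm b i * heckeNorm b i =
      (1 - T (-1) : ℂ[T;T⁻¹]) • heckeNorm b i + (1 - (1 - T (-1)) : ℂ[T;T⁻¹]) • 1 := by
  have h : (T (-1) : ℂ[T;T⁻¹]) * T 1 = 1 := by rw [← T_add]; simp
  simp only [heckeNorm, smul_mul_assoc, mul_smul_comm, heckeT_simpleRefl_sq, smul_add, smul_smul]
  match_scalars
  · linear_combination (T (-1) : ℂ[T;T⁻¹]) * h
  · linear_combination (T (-1) : ℂ[T;T⁻¹]) * h

variable (b) in
/-- The element `μ_z(s)` for a simple reflection `s`. -/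
def muSimple (i : b.support) (z : RegTorus P) : Hecke b :=
  (T (-1) : ℂ[T;T⁻¹]) • heckeT b (simpleRefl b i) +
    algebraMap ℂ[T;T⁻¹] (Hecke b)
      ((1 - T (-1)) * LaurentPolynomial.C (z.pow (P.root i) / (1 - z.pow (P.root i))))

lemma muSimple_eq (i : b.support) (z : RegTorus P) :
    muSimple b i z = heckeNorm b i +
      ((1 - T (-1)) * LaurentPolynomial.C (geomFrac (z.pow (P.root i))) : ℂ[T;T⁻¹]) • 1 := by
  rw [muSimple, Algebra.algebraMap_eq_smul_one]; rfl

variable (b) in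
/-- The product of the `μ(s)` along a word. -/
def muWord : List b.support → RegTorus P → Hecke b
  | [], _ => 1
  | i :: ω, z => muSimple b i z * muWord ω (RegTorus.act (simpleRefl b i) z)

variable (b) in
/-- The operator `φ ↦ (z ↦ μ_z(s) φ(s z))` on functions on the regular torus. -/
def muOp (i : b.support) : Function.End (RegTorus P → Hecke b) := fun φ z ↦
  muSimple b i z * φ (RegTorus.act (simpleRefl b i) z)

/-- Turns the twisted product along a word into a product in a monoid, where Matsumoto's theorem
applies. The constant function `1` recovers `muWord`. -/
lemma prod_map_muOp (ω : List b.support) (φ : RegTorus P → Hecke b) (z : RegTorus P) :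
    (ω.map (muOp b)).prod φ z = muWord b ω z * φ (RegTorus.act (wordProd b ω)⁻¹ z) := by
  induction ω generalizing z with
  | nil =>
    rw [wordProd_nil, inv_one, RegTorus.act_one, muWord, one_mul]
    rfl
  | cons i ω ih =>
    rw [List.map_cons, List.prod_cons, muWord, wordProd_cons, mul_inv_rev, simpleRefl_inv,
      ← RegTorus.act_act, mul_assoc, ← ih]
    rfl

/-- The alternating product `(t + c₀) (s + c₁) (t + c₂) ⋯` of `m` factors. -/
def altProd {R H : Type*} [CommRing R] [Ring H] [Algebra R H] (t s : H) (c : ℕ → R) : ℕ → H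
  | 0 => 1
  | m + 1 => (t + c 0 • 1) * altProd s t (fun k ↦ c (k + 1)) m

lemma prod_map_altWord {α R H : Type*} [CommRing R] [Ring H] [Algebra R H] (f : α → H) (i j : α)
    (m : ℕ) : ((altWord i j m).map f).prod = altProd (f i) (f j) (0 : ℕ → R) m := by
  induction m generalizing i j with
  | zero => rfl
  | succ m ih =>
    rw [altWord, List.map_cons, List.prod_cons, altProd, ih]
    simp only [Pi.zero_apply, zero_smul, add_zero]
    rfl

/-- The Yang-Baxter equation for a pair of simple roots. -/
lemma altProd_braid {R H : Type*} [CommRing R] [Ring H] [Algebra R H] (C : ℂ →+* R) {e : R}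
    {t s : H} (ht : t * t = e • t + (1 - e) • 1) (hs : s * s = e • s + (1 - e) • 1)
    {A B : ℤ} (hAB : IsCartanPair A B)
    (hts : altProd t s (0 : ℕ → R) (coxeterOrder A B) = altProd s t (0 : ℕ → R) (coxeterOrder A B))
    {x y : ℂ} (hxy : ∀ k, x ^ (altCoeff A B k).1 * y ^ (altCoeff A B k).2 ≠ 1)
    (hyx : ∀ k, y ^ (altCoeff B A k).1 * x ^ (altCoeff B A k).2 ≠ 1) :
    altProd t s (fun k ↦ e * C (geomFrac (x ^ (altCoeff A B k).1 * y ^ (altCoeff A B k).2)))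
      (coxeterOrder A B) =
    altProd s t (fun k ↦ e * C (geomFrac (y ^ (altCoeff B A k).1 * x ^ (altCoeff B A k).2)))
      (coxeterOrder A B) := by
  -- Exchanging the two roots leaves the four types with `A ≤ B`. In each, the second side lists the
  -- same roots in reverse order.
  wlog hle : A ≤ B generalizing A B t s x y
  · rw [coxeterOrder_comm]
    rw [coxeterOrder_comm] at hts
    exact (this hs ht hAB.symm hts.symm hyx hxy (by lia)).symm
  rcases hAB with ⟨rfl, rfl⟩ | ⟨rfl, rfl⟩ | ⟨rfl, rfl⟩ | ⟨rfl, rfl⟩ | ⟨rfl, rfl⟩ | ⟨rfl, rfl⟩ <;>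
    try omega
  · norm_num [coxeterOrder, altProd, altCoeff] at hts ⊢
    exact yangBaxter_two hts _ _
  · have h₀ := hxy 0
    have h₁ := hxy 1
    have h₂ := hxy 2
    norm_num [coxeterOrder, altProd, altCoeff] at hts h₀ h₁ h₂ ⊢
    rw [mul_comm y x]
    refine yangBaxter_three ht hs hts ?_
    simp only [← map_mul, ← map_add]
    rw [geomFrac_three h₀ h₂ h₁]
  · have h₀ := hxy 0
    have h₁ := hxy 1
    have h₂ := hxy 2
    have h₃ := hxy 3
    norm_num [coxeterOrder, altProd, altCoeff] at hts h₀ h₁ h₂ h₃ ⊢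
    rw [mul_comm y x, mul_comm (y ^ 2) x]
    refine yangBaxter_four ht hs hts ?_
    simp only [← map_mul, ← map_add]
    rw [geomFrac_four h₀ h₁ h₂ h₃]
  · have h₀ := hxy 0
    have h₁ := hxy 1
    have h₂ := hxy 2
    have h₃ := hxy 3
    have h₄ := hxy 4
    have h₅ := hxy 5
    norm_num [coxeterOrder, altProd, altCoeff] at hts h₀ h₁ h₂ h₃ h₄ h₅ ⊢
    rw [mul_comm y x, mul_comm (y ^ 2) x, mul_comm (y ^ 3) x, mul_comm (y ^ 3) (x ^ 2)]
    obtain ⟨e₁, e₂, e₃⟩ := geomFrac_six h₀ h₁ h₂ h₃ h₄ h₅ rfl rfl rfl rfl rfl rfl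
    refine yangBaxter_six ht hs hts ?_ ?_ ?_ <;> simp only [← map_mul, ← map_add]
    · rw [e₁]
    · rw [e₂]
    · rw [e₃]

/-- Moving the torus action onto characters makes the parameter of each factor depend on the image
of its root under the preceding letters. The product becomes an untwisted one, of the Yang-Baxter
shape. -/
lemma muWord_altWord (i j : b.support) (m : ℕ) (z : RegTorus P) :
    muWord b (altWord i j m) z = altProd (heckeNorm b i) (heckeNorm b j)
      (fun k ↦ ((1 - T (-1)) * LaurentPolynomial.C (geomFrac
        (z.pow (wordProd b (altWord i j k) • P.root (altLetter i j k : b.support)))) :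
          ℂ[T;T⁻¹])) m := by
  induction m generalizing i j z with
  | zero => rfl
  | succ m ih =>
    rw [altWord, muWord, altProd, ih, muSimple_eq]
    congr 2
    ext1 k
    rw [RegTorus.pow_act, simpleRefl_inv]
    simp only [altWord, altLetter, wordProd_cons, mul_smul]

lemma muWord_append (ω ω' : List b.support) (z : RegTorus P) :
    muWord b (ω ++ ω') z =
      muWord b ω z * muWord b ω' (RegTorus.act (wordProd b ω)⁻¹ z) := by
  induction ω generalizing z with
  | nil => simp [muWord]
  | cons i ω ih =>
    rw [List.cons_append, muWord, muWord, ih, wordProd_cons, mul_inv_rev, simpleRefl_inv,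
      RegTorus.act_act, mul_assoc]

section
variable [Finite ι] [P.IsReduced]

lemma prod_map_heckeNorm_of_reduced {ω : List b.support}
    (hω : length b (wordProd b ω) = ω.length) :
    (ω.map (heckeNorm b)).prod = (T (-ω.length) : ℂ[T;T⁻¹]) • heckeT b (wordProd b ω) := by
  induction ω with
  | nil => simp
  | cons i ω ih =>
    have h₁ := length_wordProd_le ω
    have h₂ := length_simpleRefl_mul_eq_or i (wordProd b ω)
    rw [wordProd_cons, List.length_cons] at hω
    rw [List.map_cons, List.prod_cons, ih (by lia), wordProd_cons, heckeNorm, smul_mul_smul_comm,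
      heckeT_simpleRefl_mul (by lia), ← T_add, List.length_cons]
    push_cast
    rw [neg_add_rev]

lemma prod_map_heckeNorm_altWord {i j : b.support} (hij : i ≠ j) :
    ((altWord i j (braidLength i j)).map (heckeNorm b)).prod =
      ((altWord j i (braidLength i j)).map (heckeNorm b)).prod := by
  rw [prod_map_heckeNorm_of_reduced, prod_map_heckeNorm_of_reduced, length_altWord,
    length_altWord, wordProd_altWord_braidLength hij]
  · rw [braidLength_comm i j, length_wordProd_altWord (Ne.symm hij) le_rfl, length_altWord]
  · rw [length_wordProd_altWord hij le_rfl, length_altWord]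

lemma muWord_braid {i j : b.support} (hij : i ≠ j) (z : RegTorus P) :
    muWord b (altWord i j (braidLength i j)) z = muWord b (altWord j i (braidLength i j)) z := by
  have ht := heckeNorm_sq i
  have hs := heckeNorm_sq j
  have h₁ := prod_map_altWord (R := ℂ[T;T⁻¹]) (heckeNorm b) i j (braidLength i j)
  have h₂ := prod_map_altWord (R := ℂ[T;T⁻¹]) (heckeNorm b) j i (braidLength i j)
  have hbraid := h₁.symm.trans ((prod_map_heckeNorm_altWord hij).trans h₂)
  rw [muWord_altWord, muWord_altWord]
  simp only [altWord_smul_root, RegTorus.pow_add, RegTorus.pow_zsmul]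
  refine altProd_braid _ ht hs (isCartanPair hij) hbraid (fun k ↦ ?_) (fun k ↦ ?_) <;>
  -- No denominator vanishes: each exponent is a Weyl translate of a simple root, hence a root.
  · rw [← RegTorus.pow_zsmul, ← RegTorus.pow_zsmul, ← RegTorus.pow_add, ← altWord_smul_root,
      ← root_smul]
    exact RegTorus.pow_root_ne_one _ _

/-! ### Existence and uniqueness of the elements `μ_z(w)` -/

lemma muWord_eq_of_reduced {ω ω' : List b.support} (hω : length b (wordProd b ω) = ω.length)
    (hω' : length b (wordProd b ω') = ω'.length) (h : wordProd b ω = wordProd b ω') :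
    muWord b ω = muWord b ω' := by
  have key := prod_map_eq_of_reduced (f := muOp b) (fun i j hij ↦ by
    funext φ z
    rw [prod_map_muOp, prod_map_muOp, muWord_braid hij, wordProd_altWord_braidLength hij]) hω hω' h
  funext z
  have := congr_fun (congr_fun key fun _ ↦ 1) z
  rwa [prod_map_muOp, prod_map_muOp, mul_one, mul_one] at this

variable (b) in
/-- The elements `μ_z(w)` of the Hecke algebra. -/
def mu (w : P.weylGroup) (z : RegTorus P) : Hecke b :=
  -- The rule for `μ_z(w₁ w₂)` puts the factor of `w₂` first, so the letters of `w` are read from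
  -- right to left.
  muWord b (exists_reduced b w⁻¹).choose z

lemma muWord_eq_mu {ω : List b.support} (hω : length b (wordProd b ω) = ω.length)
    {w : P.weylGroup} (h : wordProd b ω = w⁻¹) (z : RegTorus P) : muWord b ω z = mu b w z := by
  obtain ⟨h₁, h₂⟩ := (exists_reduced b w⁻¹).choose_spec
  rw [mu, muWord_eq_of_reduced hω (by rw [h₁, h₂]) (by rw [h, h₁])]

lemma isMu_mu : IsMu b (mu b) where
  one z := by
    rw [← muWord_eq_mu (ω := []) (by simp) (by simp)]
    rfl
  simple i z := by
    rw [← muWord_eq_mu (ω := [i]) (by simp) (by simp), muWord, muWord, mul_one]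
    rfl
  mul w₁ w₂ h z := by
    obtain ⟨ω₁, h₁, h₁'⟩ := exists_reduced b w₁⁻¹
    obtain ⟨ω₂, h₂, h₂'⟩ := exists_reduced b w₂⁻¹
    have h₃ : wordProd b (ω₂ ++ ω₁) = (w₁ * w₂)⁻¹ := by
      rw [wordProd_append, h₁, h₂, mul_inv_rev]
    rw [← muWord_eq_mu (by rw [h₁, h₁']) h₁, ← muWord_eq_mu (by rw [h₂, h₂']) h₂,
      ← muWord_eq_mu _ h₃, muWord_append, h₂, inv_inv]
    rw [h₃, length_inv, h, List.length_append, h₁', h₂', length_inv, length_inv, add_comm]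

lemma IsMu.simpleRefl_mul {μ : P.weylGroup → RegTorus P → Hecke b} (hμ : IsMu b μ)
    {i : b.support} {w : P.weylGroup} (h : length b w < length b (simpleRefl b i * w))
    (z : RegTorus P) :
    μ (simpleRefl b i * w) z = μ w z * muSimple b i (RegTorus.act w z) := by
  have := length_simpleRefl_mul_eq_or i w
  rw [hμ.mul _ _ (by rw [length_simpleRefl]; lia), hμ.simple, muSimple]

lemma IsMu.eq {μ μ' : P.weylGroup → RegTorus P → Hecke b} (hμ : IsMu b μ) (hμ' : IsMu b μ') :
    μ = μ' := by
  funext w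
  induction w using weylGroup_induction b with
  | one => funext z; rw [hμ.one, hμ'.one]
  | mul i w h ih => funext z; rw [hμ.simpleRefl_mul (by lia), hμ'.simpleRefl_mul (by lia), ih]

end

/-! ### The map `f(q) ↦ f(q⁻¹)` -/

lemma bar_add (f g : ℂ[X]) : bar (f + g) = bar f + bar g := by simp [bar]

lemma bar_sub (f g : ℂ[X]) : bar (f - g) = bar f - bar g := by simp [bar]

lemma bar_mul (f g : ℂ[X]) : bar (f * g) = bar f * bar g := by simp [bar]

@[simp] lemma bar_zero : bar 0 = 0 := by simp [bar]

@[simp] lemma bar_one : bar 1 = 1 := by simp [bar]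

@[simp] lemma bar_X : bar X = T (-1) := by simp [bar]

@[simp] lemma bar_C (c : ℂ) : bar (Polynomial.C c) = LaurentPolynomial.C c := by simp [bar]

lemma bar_injective : Function.Injective bar :=
  LaurentPolynomial.invert.injective.comp Polynomial.toLaurent_injective

lemma T_mul_cancel {n : ℤ} {f g : ℂ[T;T⁻¹]} (h : T n * f = T n * g) : f = g :=
  (isUnit_T n).mul_left_cancel h

lemma T_mul_bar_injective {n : ℤ} {f g : ℂ[X]} (h : T n * bar f = T n * bar g) : f = g :=
  bar_injective (T_mul_cancel h)

/-- Rests on `q⁻¹ (q - 1) + (1 - q⁻¹) c = (1 - q⁻¹) (1 + c)`, where `1 - q⁻¹` is `bar (1 - X)`. The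
shift from `m` to `m + 1` is the length difference of `s u` and `u`. -/
lemma T_mul_bar_down {m : ℕ} (c : ℂ) (f g : ℂ[X]) :
    T (-1) * (T (-(m : ℤ)) * bar g + (T 1 - 1) * (T (-((m + 1 : ℕ) : ℤ)) * bar f)) +
        (1 - T (-1)) * LaurentPolynomial.C c * (T (-((m + 1 : ℕ) : ℤ)) * bar f) =
      T (-((m + 1 : ℕ) : ℤ)) * bar ((1 - X) * Polynomial.C (1 + c) * f + g) := by
  have h : (T (-1) : ℂ[T;T⁻¹]) * T 1 = 1 := by rw [← T_add]; simp
  have h' : (T (-((m + 1 : ℕ) : ℤ)) : ℂ[T;T⁻¹]) = T (-1) * T (-(m : ℤ)) := by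
    rw [← T_add]; push_cast; ring_nf
  rw [h']
  simp only [bar_add, bar_mul, bar_sub, bar_one, bar_X, bar_C, map_add, map_one]
  linear_combination (T (-1) * T (-(m : ℤ)) * bar f) * h

lemma T_mul_bar_up {m : ℕ} (c : ℂ) (f g : ℂ[X]) :
    T (-1) * (T 1 * (T (-((m + 1 : ℕ) : ℤ)) * bar g)) +
        (1 - T (-1)) * LaurentPolynomial.C c * (T (-(m : ℤ)) * bar f) =
      T (-(m : ℤ)) * bar ((1 - X) * Polynomial.C c * f + X * g) := by
  have h : (T (-1) : ℂ[T;T⁻¹]) * T 1 = 1 := by rw [← T_add]; simp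
  have h' : (T (-((m + 1 : ℕ) : ℤ)) : ℂ[T;T⁻¹]) = T (-1) * T (-(m : ℤ)) := by
    rw [← T_add]; push_cast; ring_nf
  rw [h']
  simp only [bar_add, bar_mul, bar_sub, bar_one, bar_X, bar_C]
  linear_combination (T (-1) * T (-(m : ℤ)) * bar g) * h

variable (b) in
/-- The element `q⁻¹ T_s + (1 - q⁻¹) c`. -/
def shiftT (i : b.support) (c : ℂ) : Hecke b :=
  (T (-1) : ℂ[T;T⁻¹]) • heckeT b (simpleRefl b i) +
    ((1 - T (-1)) * LaurentPolynomial.C c : ℂ[T;T⁻¹]) • 1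

/-- The parameter of `shiftT` is this fraction for `μ_z(s)` and `-1` for `T_s⁻¹`, so one computation
yields the recursions for `r` and for `R`. -/
lemma muSimple_eq_shiftT (i : b.support) (z : RegTorus P) :
    muSimple b i z = shiftT b i (geomFrac (z.pow (P.root i))) := muSimple_eq i z

section
variable [Finite ι] [P.IsReduced]

/-! ### Coefficients of products with `T_s` -/

lemma repr_heckeT (w u : P.weylGroup) :
    (heckeBasis b).repr (heckeT b w) u = open Classical in if w = u then 1 else 0 := by
  classical
  rw [← heckeBasis_apply, Module.Basis.repr_self, Finsupp.single_apply]

/-- By linearity `x` may be taken to be `T_w`. For `u < u s` only `w = u s` contributes, through the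
term `q T_{w s}` of the quadratic relation. -/
lemma repr_mul_simpleRefl (x : Hecke b) {i : b.support} {u : P.weylGroup}
    (hu : length b u < length b (u * simpleRefl b i)) :
    (heckeBasis b).repr (x * heckeT b (simpleRefl b i)) u =
      T 1 * (heckeBasis b).repr x (u * simpleRefl b i) := by
  classical
  have hx : x ∈ Submodule.span ℂ[T;T⁻¹] (Set.range (heckeT b)) := by rw [span_heckeT]; trivial
  induction hx using Submodule.span_induction with
  | mem x hx =>
    obtain ⟨w, rfl⟩ := hx
    have hw : w * simpleRefl b i = u ↔ w = u * simpleRefl b i :=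
      ⟨fun h ↦ by rw [← h, simpleRefl_mul_cancel_right],
        fun h ↦ by rw [h, simpleRefl_mul_cancel_right]⟩
    by_cases h : length b w < length b (w * simpleRefl b i)
    · rw [heckeT_mul_simpleRefl h, repr_heckeT, repr_heckeT, if_neg, if_neg, mul_zero]
      · rintro rfl
        rw [simpleRefl_mul_cancel_right] at h; lia
      · rintro rfl
        rw [simpleRefl_mul_cancel_right] at hu; lia
    · have hlt : length b (w * simpleRefl b i) < length b w := by
        have := length_simpleRefl_mul_eq_or i w⁻¹
        rw [← length_mul_simpleRefl_eq, length_inv] at this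
        lia
      have hne : w ≠ u := by rintro rfl; exact h hu
      simp only [heckeT_mul_simpleRefl' hlt, map_add, map_smul, Finsupp.add_apply,
        Finsupp.smul_apply, repr_heckeT, smul_eq_mul, if_neg hne, hw]
      ring
  | zero => simp
  | add x y _ _ hx hy => simp only [add_mul, map_add, Finsupp.add_apply, hx, hy, mul_add]
  | smul c x _ hx =>
    simp only [smul_mul_assoc, map_smul, Finsupp.smul_apply, hx, smul_eq_mul]
    ring

/-- For `u s < u` there are two contributions: `w = u s` with coefficient `1` and `w = u` with
coefficient `q - 1`. -/
lemma repr_mul_simpleRefl' (x : Hecke b) {i : b.support} {u : P.weylGroup}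
    (hu : length b (u * simpleRefl b i) < length b u) :
    (heckeBasis b).repr (x * heckeT b (simpleRefl b i)) u =
      (heckeBasis b).repr x (u * simpleRefl b i) + (T 1 - 1) * (heckeBasis b).repr x u := by
  classical
  have hx : x ∈ Submodule.span ℂ[T;T⁻¹] (Set.range (heckeT b)) := by rw [span_heckeT]; trivial
  induction hx using Submodule.span_induction with
  | mem x hx =>
    obtain ⟨w, rfl⟩ := hx
    have hw : w * simpleRefl b i = u ↔ w = u * simpleRefl b i :=
      ⟨fun h ↦ by rw [← h, simpleRefl_mul_cancel_right],
        fun h ↦ by rw [h, simpleRefl_mul_cancel_right]⟩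
    by_cases h : length b w < length b (w * simpleRefl b i)
    · have hne : w ≠ u := by rintro rfl; lia
      rw [heckeT_mul_simpleRefl h, repr_heckeT, repr_heckeT, repr_heckeT, if_neg hne, mul_zero,
        add_zero]
      simp only [hw]
    · have hlt : length b (w * simpleRefl b i) < length b w := by
        have := length_simpleRefl_mul_eq_or i w⁻¹
        rw [← length_mul_simpleRefl_eq, length_inv] at this
        lia
      have hne : w ≠ u * simpleRefl b i := by
        rintro rfl
        rw [simpleRefl_mul_cancel_right] at h
        exact h hu
      simp only [heckeT_mul_simpleRefl' hlt, map_add, map_smul, Finsupp.add_apply,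
        Finsupp.smul_apply, repr_heckeT, smul_eq_mul, if_neg hne, hw]
      ring
  | zero => simp
  | add x y _ _ hx hy => simp only [add_mul, map_add, Finsupp.add_apply, hx, hy]; ring
  | smul c x _ hx =>
    simp only [smul_mul_assoc, map_smul, Finsupp.smul_apply, hx, smul_eq_mul]
    ring

lemma repr_simpleRefl_mul (x : Hecke b) {i : b.support} {u : P.weylGroup}
    (hu : length b u < length b (simpleRefl b i * u)) :
    (heckeBasis b).repr (heckeT b (simpleRefl b i) * x) u =
      T 1 * (heckeBasis b).repr x (simpleRefl b i * u) := by
  classical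
  have hx : x ∈ Submodule.span ℂ[T;T⁻¹] (Set.range (heckeT b)) := by rw [span_heckeT]; trivial
  induction hx using Submodule.span_induction with
  | mem x hx =>
    obtain ⟨w, rfl⟩ := hx
    have hw : simpleRefl b i * w = u ↔ w = simpleRefl b i * u :=
      ⟨fun h ↦ by rw [← h, simpleRefl_mul_cancel_left],
        fun h ↦ by rw [h, simpleRefl_mul_cancel_left]⟩
    rcases length_simpleRefl_mul_eq_or i w with h | h
    · rw [heckeT_simpleRefl_mul (by lia), repr_heckeT, repr_heckeT, if_neg, if_neg, mul_zero]
      · rintro rfl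
        rw [simpleRefl_mul_cancel_left] at h; lia
      · rintro rfl
        rw [simpleRefl_mul_cancel_left] at hu; lia
    · have hne : w ≠ u := by rintro rfl; lia
      simp only [heckeT_simpleRefl_mul' (w := w) (i := i) (by lia), map_add, map_smul,
        Finsupp.add_apply, Finsupp.smul_apply, repr_heckeT, smul_eq_mul, if_neg hne, hw]
      ring
  | zero => simp
  | add x y _ _ hx hy => simp only [mul_add, map_add, Finsupp.add_apply, hx, hy]
  | smul c x _ hx =>
    simp only [mul_smul_comm, map_smul, Finsupp.smul_apply, hx, smul_eq_mul]
    ring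

lemma repr_simpleRefl_mul' (x : Hecke b) {i : b.support} {u : P.weylGroup}
    (hu : length b (simpleRefl b i * u) < length b u) :
    (heckeBasis b).repr (heckeT b (simpleRefl b i) * x) u =
      (heckeBasis b).repr x (simpleRefl b i * u) + (T 1 - 1) * (heckeBasis b).repr x u := by
  classical
  have hx : x ∈ Submodule.span ℂ[T;T⁻¹] (Set.range (heckeT b)) := by rw [span_heckeT]; trivial
  induction hx using Submodule.span_induction with
  | mem x hx =>
    obtain ⟨w, rfl⟩ := hx
    have hw : simpleRefl b i * w = u ↔ w = simpleRefl b i * u :=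
      ⟨fun h ↦ by rw [← h, simpleRefl_mul_cancel_left],
        fun h ↦ by rw [h, simpleRefl_mul_cancel_left]⟩
    rcases length_simpleRefl_mul_eq_or i w with h | h
    · have hne : w ≠ u := by rintro rfl; lia
      rw [heckeT_simpleRefl_mul (by lia), repr_heckeT, repr_heckeT, repr_heckeT, if_neg hne,
        mul_zero, add_zero]
      simp only [hw]
    · have hne : w ≠ simpleRefl b i * u := by
        rintro rfl
        rw [simpleRefl_mul_cancel_left] at h
        lia
      simp only [heckeT_simpleRefl_mul' (w := w) (i := i) (by lia), map_add, map_smul,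
        Finsupp.add_apply, Finsupp.smul_apply, repr_heckeT, smul_eq_mul, if_neg hne, hw]
      ring
  | zero => simp
  | add x y _ _ hx hy => simp only [mul_add, map_add, Finsupp.add_apply, hx, hy]; ring
  | smul c x _ hx =>
    simp only [mul_smul_comm, map_smul, Finsupp.smul_apply, hx, smul_eq_mul]
    ring

lemma repr_mul_shiftT_down {x : Hecke b} {i : b.support} {u : P.weylGroup}
    (hu : length b (simpleRefl b i * u) < length b u) (c : ℂ) {f g : ℂ[X]}
    (hf : (heckeBasis b).repr x u⁻¹ = T (-(length b u : ℤ)) * bar f)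
    (hg : (heckeBasis b).repr x (simpleRefl b i * u)⁻¹ =
      T (-(length b (simpleRefl b i * u) : ℤ)) * bar g) :
    (heckeBasis b).repr (x * shiftT b i c) u⁻¹ =
      T (-(length b u : ℤ)) * bar ((1 - X) * Polynomial.C (1 + c) * f + g) := by
  have h₁ : length b (u⁻¹ * simpleRefl b i) < length b u⁻¹ := by
    rwa [length_mul_simpleRefl_eq, inv_inv, length_inv]
  have h₂ := length_simpleRefl_mul_eq_or i u
  have h₃ : length b u = length b (simpleRefl b i * u) + 1 := by lia
  rw [mul_inv_rev, simpleRefl_inv] at hg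
  rw [shiftT, mul_add, mul_smul_comm, mul_smul_comm, mul_one, map_add (heckeBasis b).repr,
    map_smul, map_smul, Finsupp.add_apply, Finsupp.smul_apply, Finsupp.smul_apply,
    repr_mul_simpleRefl' x h₁, hf, hg, smul_eq_mul, smul_eq_mul, h₃, T_mul_bar_down]

lemma repr_mul_shiftT_up {x : Hecke b} {i : b.support} {u : P.weylGroup}
    (hu : length b u < length b (simpleRefl b i * u)) (c : ℂ) {f g : ℂ[X]}
    (hf : (heckeBasis b).repr x u⁻¹ = T (-(length b u : ℤ)) * bar f)
    (hg : (heckeBasis b).repr x (simpleRefl b i * u)⁻¹ =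
      T (-(length b (simpleRefl b i * u) : ℤ)) * bar g) :
    (heckeBasis b).repr (x * shiftT b i c) u⁻¹ =
      T (-(length b u : ℤ)) * bar ((1 - X) * Polynomial.C c * f + X * g) := by
  have h₁ : length b u⁻¹ < length b (u⁻¹ * simpleRefl b i) := by
    rwa [length_mul_simpleRefl_eq, inv_inv, length_inv]
  have h₂ := length_simpleRefl_mul_eq_or i u
  have h₃ : length b (simpleRefl b i * u) = length b u + 1 := by lia
  rw [mul_inv_rev, simpleRefl_inv] at hg
  simp only [shiftT, mul_add, mul_smul_comm, mul_one, map_add, map_smul, Finsupp.add_apply,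
    Finsupp.smul_apply, repr_mul_simpleRefl x h₁, hf, hg, smul_eq_mul]
  rw [h₃, T_mul_bar_up]

/-- Mirror image for `R`, which is expanded in `T_u` rather than `T_{u⁻¹}`, so that the new factor
enters on the left. -/
lemma repr_shiftT_mul_down {x : Hecke b} {i : b.support} {u : P.weylGroup}
    (hu : length b (simpleRefl b i * u) < length b u) (c : ℂ) {f g : ℂ[X]}
    (hf : (heckeBasis b).repr x u = T (-(length b u : ℤ)) * bar f)
    (hg : (heckeBasis b).repr x (simpleRefl b i * u) =
      T (-(length b (simpleRefl b i * u) : ℤ)) * bar g) :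
    (heckeBasis b).repr (shiftT b i c * x) u =
      T (-(length b u : ℤ)) * bar ((1 - X) * Polynomial.C (1 + c) * f + g) := by
  have h₂ := length_simpleRefl_mul_eq_or i u
  have h₃ : length b u = length b (simpleRefl b i * u) + 1 := by lia
  rw [shiftT, add_mul, smul_mul_assoc, smul_mul_assoc, one_mul, map_add (heckeBasis b).repr,
    map_smul, map_smul, Finsupp.add_apply, Finsupp.smul_apply, Finsupp.smul_apply,
    repr_simpleRefl_mul' x hu, hf, hg, smul_eq_mul, smul_eq_mul, h₃, T_mul_bar_down]

lemma repr_shiftT_mul_up {x : Hecke b} {i : b.support} {u : P.weylGroup}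
    (hu : length b u < length b (simpleRefl b i * u)) (c : ℂ) {f g : ℂ[X]}
    (hf : (heckeBasis b).repr x u = T (-(length b u : ℤ)) * bar f)
    (hg : (heckeBasis b).repr x (simpleRefl b i * u) =
      T (-(length b (simpleRefl b i * u) : ℤ)) * bar g) :
    (heckeBasis b).repr (shiftT b i c * x) u =
      T (-(length b u : ℤ)) * bar ((1 - X) * Polynomial.C c * f + X * g) := by
  have h₂ := length_simpleRefl_mul_eq_or i u
  have h₃ : length b (simpleRefl b i * u) = length b u + 1 := by lia
  simp only [shiftT, add_mul, smul_mul_assoc, one_mul, map_add, map_smul, Finsupp.add_apply,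
    Finsupp.smul_apply, repr_simpleRefl_mul x hu, hf, hg, smul_eq_mul]
  rw [h₃, T_mul_bar_up]

end

lemma one_add_geomFrac {x : ℂ} (hx : x ≠ 1) : 1 + geomFrac x = 1 / (1 - x) := by
  have : 1 - x ≠ 0 := sub_ne_zero.2 hx.symm
  rw [geomFrac]
  field_simp
  ring

lemma RegTorus.pow_smul_root_ne_one (z : RegTorus P) (w : P.weylGroup) (i : ι) :
    z.pow (w • P.root i) ≠ 1 := by
  rw [← root_smul]
  exact z.pow_root_ne_one _

/-! ### Regularity of the coefficients -/

/-- A family of polynomials whose coefficients are regular functions on the regular torus. -/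
def HasRegularCoeffs (f : RegTorus P → ℂ[X]) : Prop :=
  ∀ n, (fun z ↦ (f z).coeff n) ∈ regularFunctions P

lemma HasRegularCoeffs.add {f g : RegTorus P → ℂ[X]} (hf : HasRegularCoeffs f)
    (hg : HasRegularCoeffs g) : HasRegularCoeffs fun z ↦ f z + g z := fun n ↦ by
  simp only [coeff_add]
  exact add_mem (hf n) (hg n)

lemma HasRegularCoeffs.mul {f g : RegTorus P → ℂ[X]} (hf : HasRegularCoeffs f)
    (hg : HasRegularCoeffs g) : HasRegularCoeffs fun z ↦ f z * g z := fun n ↦ by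
  have : (fun z ↦ (f z * g z).coeff n) = ∑ p ∈ Finset.HasAntidiagonal.antidiagonal n,
      (fun z ↦ (f z).coeff p.1) * (fun z ↦ (g z).coeff p.2) := by
    ext z
    simp [coeff_mul, Finset.sum_apply]
  rw [this]
  exact sum_mem fun p _ ↦ mul_mem (hf _) (hg _)

lemma hasRegularCoeffs_const (p : ℂ[X]) : HasRegularCoeffs fun _ : RegTorus P ↦ p := fun n ↦
  (regularFunctions P).algebraMap_mem (p.coeff n)

lemma hasRegularCoeffs_C {f : RegTorus P → ℂ} (hf : f ∈ regularFunctions P) :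
    HasRegularCoeffs fun z ↦ Polynomial.C (f z) := fun n ↦ by
  simp only [Polynomial.coeff_C]
  split_ifs
  · exact hf
  · exact zero_mem _

lemma inv_one_sub_mem_regularFunctions (w : P.weylGroup) (i : ι) :
    (fun z : RegTorus P ↦ 1 / (1 - z.pow (w • P.root i))) ∈ regularFunctions P := by
  refine Algebra.subset_adjoin (.inr ⟨w • i, ?_⟩)
  ext z
  simp only [root_smul, one_div]

lemma div_one_sub_mem_regularFunctions (w : P.weylGroup) (i : ι) :
    (fun z : RegTorus P ↦ z.pow (w • P.root i) / (1 - z.pow (w • P.root i))) ∈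
      regularFunctions P := by
  have h : (fun z : RegTorus P ↦ z.pow (w • P.root i)) ∈ regularFunctions P :=
    Algebra.subset_adjoin (.inl ⟨_, rfl⟩)
  convert! mul_mem h (inv_one_sub_mem_regularFunctions w i) using 1
  ext z
  simp [div_eq_mul_inv]

/-! ### Convergence of polynomials -/

/-- Convergence of a family of polynomials, both for coefficients and for values. -/
def TendstoPoly {α : Type*} (f : α → ℂ[X]) (l : Filter α) (p : ℂ[X]) : Prop :=
  (∀ n, Tendsto (fun z ↦ (f z).coeff n) l (𝓝 (p.coeff n))) ∧
    ∀ q, Tendsto (fun z ↦ (f z).eval q) l (𝓝 (p.eval q))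

lemma tendsto_atInfinity {i : ι} (hi : b.IsPos i) :
    Tendsto (fun z : RegTorus P ↦ z.pow (P.root i)) (atInfinity b) (Bornology.cobounded ℂ) :=
  tendsto_iff_comap.2 (iInf₂_le i hi)

lemma tendsto_inv_one_sub {i : ι} (hi : b.IsPos i) :
    Tendsto (fun z : RegTorus P ↦ 1 / (1 - z.pow (P.root i))) (atInfinity b) (𝓝 0) := by
  have h := tendsto_inv₀_cobounded.comp
    ((tendsto_const_sub_cobounded (1 : ℂ)).comp (tendsto_atInfinity hi))
  simpa [Function.comp_def] using h

namespace TendstoPoly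

variable {α : Type*} {l : Filter α} {f g : α → ℂ[X]} {p p' : ℂ[X]}

lemma const (p : ℂ[X]) : TendstoPoly (fun _ : α ↦ p) l p :=
  ⟨fun _ ↦ tendsto_const_nhds, fun _ ↦ tendsto_const_nhds⟩

lemma add (hf : TendstoPoly f l p) (hg : TendstoPoly g l p') :
    TendstoPoly (fun z ↦ f z + g z) l (p + p') :=
  ⟨fun n ↦ by simpa using (hf.1 n).add (hg.1 n), fun q ↦ by simpa using (hf.2 q).add (hg.2 q)⟩

lemma mul (hf : TendstoPoly f l p) (hg : TendstoPoly g l p') :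
    TendstoPoly (fun z ↦ f z * g z) l (p * p') :=
  ⟨fun n ↦ by
    simp only [coeff_mul]
    exact tendsto_finsetSum _ fun x _ ↦ (hf.1 _).mul (hg.1 _),
  fun q ↦ by simpa using (hf.2 q).mul (hg.2 q)⟩

lemma C {f : α → ℂ} {c : ℂ} (hf : Tendsto f l (𝓝 c)) :
    TendstoPoly (fun z ↦ Polynomial.C (f z)) l (Polynomial.C c) :=
  ⟨fun n ↦ by
    simp only [Polynomial.coeff_C]
    split_ifs
    · exact hf
    · exact tendsto_const_nhds, fun q ↦ by simpa using hf⟩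

end TendstoPoly

/-! ### Inverses of the generators -/

lemma heckeT_mul_shiftT (i : b.support) :
    heckeT b (simpleRefl b i) * shiftT b i (-1) = 1 := by
  have h : (T (-1) : ℂ[T;T⁻¹]) * T 1 = 1 := by rw [← T_add]; simp
  rw [shiftT, mul_add, mul_smul_comm, mul_smul_comm, heckeT_simpleRefl_sq, mul_one, map_neg,
    map_one]
  match_scalars
  · linear_combination h
  · linear_combination h

lemma shiftT_mul_heckeT (i : b.support) :
    shiftT b i (-1) * heckeT b (simpleRefl b i) = 1 := by
  rw [← heckeT_mul_shiftT i, shiftT, mul_add, add_mul, mul_smul_comm, mul_smul_comm,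
    smul_mul_assoc, smul_mul_assoc, one_mul, mul_one]

section
variable [Finite ι] [P.IsReduced]

/-! ### The deformed polynomials `r_{u,v}` -/

lemma repr_one (u : P.weylGroup) :
    (heckeBasis b).repr 1 u = open Classical in if u = 1 then 1 else 0 := by
  classical
  rw [← heckeT_one, repr_heckeT]
  simp only [eq_comm]

lemma lt_simpleRefl_mul_or (i : b.support) (u : P.weylGroup) :
    length b (simpleRefl b i * u) < length b u ∨ length b u < length b (simpleRefl b i * u) := by
  have := length_simpleRefl_mul_eq_or i u
  lia

variable (b) in
-- The content is that each coefficient, multiplied by `q ^ l(u)`, is a polynomial in `q⁻¹`; the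
-- recursion preserves this.
lemma exists_isDeformedR : ∃ r, IsDeformedR b (heckeBasis b) (mu b) r := by
  classical
  suffices ∀ (v : P.weylGroup) (u : P.weylGroup) (z : RegTorus P), ∃ f : ℂ[X],
      (heckeBasis b).repr (mu b v z) u⁻¹ = T (-(length b u : ℤ)) * bar f by
    choose r hr using this
    exact ⟨fun u v z ↦ r v u z, fun u v z ↦ hr v u z⟩
  intro v
  induction v using weylGroup_induction b with
  | one =>
    intro u z
    refine ⟨if u = 1 then 1 else 0, ?_⟩
    rw [isMu_mu.one, repr_one]
    by_cases h : u = 1 <;> simp [h]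
  | mul i w h ih =>
    intro u z
    obtain ⟨f, hf⟩ := ih u z
    obtain ⟨g, hg⟩ := ih (simpleRefl b i * u) z
    rw [isMu_mu.simpleRefl_mul (by lia), muSimple_eq_shiftT]
    rcases lt_simpleRefl_mul_or i u with hu | hu
    · exact ⟨_, repr_mul_shiftT_down hu _ hf hg⟩
    · exact ⟨_, repr_mul_shiftT_up hu _ hf hg⟩

section
variable {r : P.weylGroup → P.weylGroup → RegTorus P → ℂ[X]}
  (hr : IsDeformedR b (heckeBasis b) (mu b) r)
include hr

lemma IsDeformedR.eq {r' : P.weylGroup → P.weylGroup → RegTorus P → ℂ[X]}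
    (hr' : IsDeformedR b (heckeBasis b) (mu b) r') : r = r' := by
  funext u v z
  exact T_mul_bar_injective ((hr u v z).symm.trans (hr' u v z))

lemma IsDeformedR.one (u : P.weylGroup) (z : RegTorus P) :
    r u 1 z = open Classical in if u = 1 then 1 else 0 := by
  classical
  refine T_mul_bar_injective ((hr u 1 z).symm.trans ?_)
  rw [isMu_mu.one, repr_one]
  by_cases h : u = 1 <;> simp [h]

/-- The parameter of the last factor in `μ_z(sw) = μ_z(w) μ_{wz}(s)` comes from `(wz)^α = z^{w⁻¹
α}`. For `v = sw` the exponent is `-v⁻¹ α`. -/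
lemma IsDeformedR.down {i : b.support} {u w : P.weylGroup}
    (hu : length b (simpleRefl b i * u) < length b u)
    (hw : length b w < length b (simpleRefl b i * w)) (z : RegTorus P) :
    r u (simpleRefl b i * w) z =
      (1 - X) * Polynomial.C (1 / (1 - z.pow (w⁻¹ • P.root i))) * r u w z +
        r (simpleRefl b i * u) w z := by
  have h := hr u (simpleRefl b i * w) z
  rw [isMu_mu.simpleRefl_mul hw, muSimple_eq_shiftT,
    repr_mul_shiftT_down hu _ (hr u w z) (hr _ w z), RegTorus.pow_act,
    one_add_geomFrac (z.pow_smul_root_ne_one _ _)] at h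
  exact (T_mul_bar_injective h).symm

lemma IsDeformedR.up {i : b.support} {u w : P.weylGroup}
    (hu : length b u < length b (simpleRefl b i * u))
    (hw : length b w < length b (simpleRefl b i * w)) (z : RegTorus P) :
    r u (simpleRefl b i * w) z =
      (1 - X) * Polynomial.C (z.pow (w⁻¹ • P.root i) / (1 - z.pow (w⁻¹ • P.root i))) * r u w z +
        X * r (simpleRefl b i * u) w z := by
  have h := hr u (simpleRefl b i * w) z
  rw [isMu_mu.simpleRefl_mul hw, muSimple_eq_shiftT,
    repr_mul_shiftT_up hu _ (hr u w z) (hr _ w z), RegTorus.pow_act] at h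
  exact (T_mul_bar_injective h).symm

/-- Both terms of the recursion vanish: `u ≤ w` would give `u ≤ s w` by transitivity, and `s u ≤ w`
would give it by the lifting property. -/
lemma IsDeformedR.eq_zero {u v : P.weylGroup} (huv : ¬ BruhatLE b u v) (z : RegTorus P) :
    r u v z = 0 := by
  induction v using weylGroup_induction b generalizing u with
  | one =>
    rw [hr.one, if_neg]
    rintro rfl
    exact huv (.refl 1)
  | mul i w h ih =>
    have hw : length b w < length b (simpleRefl b i * w) := by lia
    have h₁ : ¬ BruhatLE b u w := fun h' ↦ huv (h'.trans (bruhatLE_simpleRefl_mul hw))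
    have h₂ : ¬ BruhatLE b (simpleRefl b i * u) w := fun h' ↦
      huv (by simpa using h'.simpleRefl_mul i hw)
    rcases lt_simpleRefl_mul_or i u with hu | hu
    · rw [hr.down hu hw, ih h₁, ih h₂]; simp
    · rw [hr.up hu hw, ih h₁, ih h₂]; simp

lemma IsDeformedR.self (u : P.weylGroup) (z : RegTorus P) : r u u z = 1 := by
  induction u using weylGroup_induction b with
  | one => rw [hr.one, if_pos rfl]
  | mul i w h ih =>
    have hw : length b w < length b (simpleRefl b i * w) := by lia
    -- The first term carries `r` at the pair `(s w, w)`, which vanishes because `s w` is longer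
    -- than `w`.
    rw [hr.down (by simpa using hw) hw, simpleRefl_mul_cancel_left, ih, hr.eq_zero]
    · simp
    · intro h'
      rcases h'.length_le with h' | h'
      · rw [h'] at hw; lia
      · lia

end

lemma IsDeformedR.hasRegularCoeffs {r : P.weylGroup → P.weylGroup → RegTorus P → ℂ[X]}
    (hr : IsDeformedR b (heckeBasis b) (mu b) r) (u v : P.weylGroup) :
    HasRegularCoeffs (r u v) := by
  induction v using weylGroup_induction b generalizing u with
  | one =>
    rw [show r u 1 = _ from funext fun z ↦ hr.one u z]
    exact hasRegularCoeffs_const _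
  | mul i w h ih =>
    have hw : length b w < length b (simpleRefl b i * w) := by lia
    rcases lt_simpleRefl_mul_or i u with hu | hu
    · rw [show r u (simpleRefl b i * w) = _ from funext fun z ↦ hr.down hu hw z]
      exact (((hasRegularCoeffs_const _).mul
        (hasRegularCoeffs_C (inv_one_sub_mem_regularFunctions _ _))).mul (ih u)).add (ih _)
    · rw [show r u (simpleRefl b i * w) = _ from funext fun z ↦ hr.up hu hw z]
      exact (((hasRegularCoeffs_const _).mul
        (hasRegularCoeffs_C (div_one_sub_mem_regularFunctions _ _))).mul (ih u)).add
          ((hasRegularCoeffs_const _).mul (ih _))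

/-! ### The Kazhdan-Lusztig `R`-polynomials -/

lemma heckeT_inv_mul_shiftT {i : b.support} {w : P.weylGroup}
    (h : length b w < length b (simpleRefl b i * w)) {t : Hecke b}
    (ht : heckeT b w⁻¹ * t = 1 ∧ t * heckeT b w⁻¹ = 1) :
    heckeT b (simpleRefl b i * w)⁻¹ * (shiftT b i (-1) * t) = 1 ∧
      (shiftT b i (-1) * t) * heckeT b (simpleRefl b i * w)⁻¹ = 1 := by
  have h' : heckeT b (simpleRefl b i * w)⁻¹ = heckeT b w⁻¹ * heckeT b (simpleRefl b i) := by
    rw [heckeT_mul_simpleRefl, mul_inv_rev, simpleRefl_inv]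
    rwa [length_mul_simpleRefl_eq, inv_inv, length_inv]
  rw [h']
  constructor
  · rw [mul_assoc, ← mul_assoc (heckeT b (simpleRefl b i)), heckeT_mul_shiftT, one_mul, ht.1]
  · rw [mul_assoc, ← mul_assoc t, ht.2, one_mul, shiftT_mul_heckeT]

variable (b) in
lemma exists_isKLR : ∃ R, IsKLR b (heckeBasis b) R := by
  classical
  suffices ∀ v : P.weylGroup, ∃ (S : P.weylGroup → ℤ[X]) (t : Hecke b),
      heckeT b v⁻¹ * t = 1 ∧ t * heckeT b v⁻¹ = 1 ∧ ∀ u, (heckeBasis b).repr t u =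
        T (-(length b u : ℤ)) * bar ((S u).map (Int.castRingHom ℂ)) by
    choose R hR using this
    exact ⟨fun u v ↦ R v u, hR⟩
  intro v
  induction v using weylGroup_induction b with
  | one =>
    refine ⟨fun u ↦ if u = 1 then 1 else 0, 1, by simp, by simp, fun u ↦ ?_⟩
    rw [repr_one]
    by_cases h : u = 1 <;> simp [h]
  | mul i w h ih =>
    obtain ⟨S, t, ht, ht', hS⟩ := ih
    obtain ⟨h₁, h₂⟩ := heckeT_inv_mul_shiftT (i := i) (w := w) (by lia) ⟨ht, ht'⟩
    -- The recursion with `c = -1`: the factor `1 + c` kills the first term when `s u < u`, and `(1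
    -- - X) c` is `X - 1` otherwise. In particular the coefficients stay integral.
    refine ⟨fun u ↦ if length b (simpleRefl b i * u) < length b u then S (simpleRefl b i * u)
      else (X - 1) * S u + X * S (simpleRefl b i * u), _, h₁, h₂, fun u ↦ ?_⟩
    rcases lt_simpleRefl_mul_or i u with hu | hu
    · rw [repr_shiftT_mul_down hu _ (hS u) (hS _)]
      simp [hu]
    · rw [repr_shiftT_mul_up hu _ (hS u) (hS _)]
      simp [hu.not_gt]

section
variable {R : P.weylGroup → P.weylGroup → ℤ[X]} (hR : IsKLR b (heckeBasis b) R)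
include hR

lemma IsKLR.eq {R' : P.weylGroup → P.weylGroup → ℤ[X]} (hR' : IsKLR b (heckeBasis b) R') :
    R = R' := by
  funext u v
  obtain ⟨t, h₁, h₂, h₃⟩ := hR v
  obtain ⟨t', h₁', h₂', h₃'⟩ := hR' v
  obtain rfl : t = t' := left_inv_eq_right_inv h₂ h₁'
  exact Polynomial.map_injective _ Int.cast_injective
    (T_mul_bar_injective ((h₃ u).symm.trans (h₃' u)))

lemma IsKLR.one (u : P.weylGroup) : R u 1 = open Classical in if u = 1 then 1 else 0 := by
  classical
  obtain ⟨t, h₁, h₂, h₃⟩ := hR 1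
  obtain rfl : t = 1 := by simpa using h₁
  refine Polynomial.map_injective _ (Int.cast_injective (α := ℂ))
    (T_mul_bar_injective ((h₃ u).symm.trans ?_))
  rw [repr_one]
  by_cases h : u = 1 <;> simp [h]

lemma IsKLR.down {i : b.support} {u w : P.weylGroup}
    (hu : length b (simpleRefl b i * u) < length b u)
    (hw : length b w < length b (simpleRefl b i * w)) :
    R u (simpleRefl b i * w) = R (simpleRefl b i * u) w := by
  obtain ⟨t, h₁, h₂, h₃⟩ := hR (simpleRefl b i * w)
  obtain ⟨t', h₁', h₂', h₃'⟩ := hR w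
  obtain rfl : t = _ := left_inv_eq_right_inv h₂ (heckeT_inv_mul_shiftT hw ⟨h₁', h₂'⟩).1
  refine Polynomial.map_injective _ (Int.cast_injective (α := ℂ))
    (T_mul_bar_injective ((h₃ u).symm.trans ?_))
  rw [repr_shiftT_mul_down hu _ (h₃' u) (h₃' _)]
  simp

lemma IsKLR.up {i : b.support} {u w : P.weylGroup}
    (hu : length b u < length b (simpleRefl b i * u))
    (hw : length b w < length b (simpleRefl b i * w)) :
    R u (simpleRefl b i * w) = (X - 1) * R u w + X * R (simpleRefl b i * u) w := by
  obtain ⟨t, h₁, h₂, h₃⟩ := hR (simpleRefl b i * w)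
  obtain ⟨t', h₁', h₂', h₃'⟩ := hR w
  obtain rfl : t = _ := left_inv_eq_right_inv h₂ (heckeT_inv_mul_shiftT hw ⟨h₁', h₂'⟩).1
  refine Polynomial.map_injective _ (Int.cast_injective (α := ℂ))
    (T_mul_bar_injective ((h₃ u).symm.trans ?_))
  rw [repr_shiftT_mul_up hu _ (h₃' u) (h₃' _)]
  simp

end

/-! ### The limit at infinity -/

/-- Since `w < s w`, the root `w⁻¹ α` is positive. So `1 / (1 - z^{w⁻¹ α})` tends to `0` and `z^{w⁻¹
α} / (1 - z^{w⁻¹ α})` to `-1`, which turns the recursion of `r` into that of `R`. -/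
lemma tendstoPoly_atInfinity {r : P.weylGroup → P.weylGroup → RegTorus P → ℂ[X]}
    (hr : IsDeformedR b (heckeBasis b) (mu b) r) {R : P.weylGroup → P.weylGroup → ℤ[X]}
    (hR : IsKLR b (heckeBasis b) R) (u v : P.weylGroup) :
    TendstoPoly (r u v) (atInfinity b) ((R u v).map (Int.castRingHom ℂ)) := by
  induction v using weylGroup_induction b generalizing u with
  | one =>
    rw [show r u 1 = _ from funext fun z ↦ hr.one u z, hR.one]
    split_ifs <;> simpa using! TendstoPoly.const _
  | mul i w h ih =>
    have hw : length b w < length b (simpleRefl b i * w) := by lia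
    have hpos : b.IsPos (w⁻¹ • (i : ι)) := by
      rw [← not_not (a := b.IsPos _), ← length_simpleRefl_mul_lt_iff]
      lia
    have h₀ := tendsto_inv_one_sub hpos
    simp only [root_smul] at h₀
    rcases lt_simpleRefl_mul_or i u with hu | hu
    · rw [show r u (simpleRefl b i * w) = _ from funext fun z ↦ hr.down hu hw z, hR.down hu hw]
      simpa using (((TendstoPoly.const (1 - X)).mul (.C h₀)).mul (ih u)).add (ih _)
    · rw [show r u (simpleRefl b i * w) = _ from funext fun z ↦ hr.up hu hw z, hR.up hu hw]
      have h₁ : Tendsto (fun z : RegTorus P ↦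
          z.pow (w⁻¹ • P.root i) / (1 - z.pow (w⁻¹ • P.root i))) (atInfinity b) (𝓝 (-1)) := by
        have : (fun z : RegTorus P ↦ z.pow (w⁻¹ • P.root i) / (1 - z.pow (w⁻¹ • P.root i))) =
            fun z ↦ 1 / (1 - z.pow (w⁻¹ • P.root i)) + -1 := by
          ext z
          rw [← one_add_geomFrac (z.pow_smul_root_ne_one _ _), geomFrac]
          ring
        rw [this]
        simpa using h₀.add_const (-1)
      have h₂ : ((X - 1) * R u w + X * R (simpleRefl b i * u) w).map (Int.castRingHom ℂ) =
          (1 - X) * Polynomial.C (-1) * (R u w).map (Int.castRingHom ℂ) +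
            X * (R (simpleRefl b i * u) w).map (Int.castRingHom ℂ) := by
        rw [Polynomial.map_add, Polynomial.map_mul, Polynomial.map_mul, Polynomial.map_sub,
          Polynomial.map_X, Polynomial.map_one, map_neg, map_one]
        ring
      rw [h₂]
      exact (((TendstoPoly.const (1 - X)).mul (.C h₁)).mul (ih u)).add
        ((TendstoPoly.const X).mul (ih _))

end

end DeformedR

end

/-! ### The main theorem -/

theorem mainTheorem2 {ι M N : Type*} [Finite ι] [AddCommGroup M] [AddCommGroup N]
    [Module.Free ℤ M] [Module.Finite ℤ M] (P : RootPairing ι ℤ M N) [P.IsReduced] (b : P.Base) :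
    -- the `T_w` form a basis `B` of the Hecke algebra
    ∃ B : Module.Basis P.weylGroup ℂ[T;T⁻¹] (DeformedR.Hecke b),
      (∀ w, B w = DeformedR.heckeT b w) ∧
    -- the `μ_z(w)`, the coefficients `r_{u,v}(z)` and the `R`-polynomials exist and are unique
    ∃ (μ : P.weylGroup → DeformedR.RegTorus P → DeformedR.Hecke b)
      (r : P.weylGroup → P.weylGroup → DeformedR.RegTorus P → ℂ[X])
      (R : P.weylGroup → P.weylGroup → ℤ[X]),
      (DeformedR.IsMu b μ ∧ ∀ μ', DeformedR.IsMu b μ' → μ' = μ) ∧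
      (DeformedR.IsDeformedR b B μ r ∧ ∀ r', DeformedR.IsDeformedR b B μ r' → r' = r) ∧
      (DeformedR.IsKLR b B R ∧ ∀ R', DeformedR.IsKLR b B R' → R' = R) ∧
      -- the coefficients of `r_{u,v}(z)` are regular functions of `z` on the regular set
      (∀ u v n, (fun z ↦ (r u v z).coeff n) ∈ DeformedR.regularFunctions P) ∧
      (∀ u z, r u u z = 1) ∧
      (∀ u v, ¬ DeformedR.BruhatLE b u v → ∀ z, r u v z = 0) ∧
      -- `r_{u,v}(z) → R_{u,v}`, for each coefficient and for each value of `q`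
      (∀ u v,
        (∀ n, Tendsto (fun z ↦ (r u v z).coeff n) (DeformedR.atInfinity b)
          (𝓝 (((R u v).coeff n : ℤ) : ℂ))) ∧
        (∀ q : ℂ, Tendsto (fun z ↦ (r u v z).eval q) (DeformedR.atInfinity b)
          (𝓝 (Polynomial.aeval q (R u v))))) ∧
      -- the recursion, for each left descent `s = s_α` of `v`, with `Z = z ^ (-v⁻¹ α)`
      (∀ (u v : P.weylGroup) (i : b.support),
        DeformedR.BruhatLT b (DeformedR.simpleRefl b i * v) v →
        ∀ (z : DeformedR.RegTorus P) (Z : ℂ), Z = z.pow (-(v⁻¹ • P.root i)) →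
          (DeformedR.BruhatLT b (DeformedR.simpleRefl b i * u) u →
            r u v z =
              (1 - X) * Polynomial.C (1 / (1 - Z)) * r u (DeformedR.simpleRefl b i * v) z +
                r (DeformedR.simpleRefl b i * u) (DeformedR.simpleRefl b i * v) z) ∧
          (DeformedR.BruhatLT b u (DeformedR.simpleRefl b i * u) →
            r u v z =
              (1 - X) * Polynomial.C (Z / (1 - Z)) * r u (DeformedR.simpleRefl b i * v) z +
                X * r (DeformedR.simpleRefl b i * u) (DeformedR.simpleRefl b i * v) z)) := by
  obtain ⟨r, hr⟩ := DeformedR.exists_isDeformedR b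
  obtain ⟨R, hR⟩ := DeformedR.exists_isKLR b
  refine ⟨DeformedR.heckeBasis b, DeformedR.heckeBasis_apply, DeformedR.mu b, r, R,
    ⟨DeformedR.isMu_mu, fun μ' h ↦ h.eq DeformedR.isMu_mu⟩, ⟨hr, fun r' h ↦ h.eq hr⟩,
    ⟨hR, fun R' h ↦ h.eq hR⟩, hr.hasRegularCoeffs, hr.self, fun u v h z ↦ hr.eq_zero h z,
    fun u v ↦ ⟨fun n ↦ ?_, fun q ↦ ?_⟩, fun u v i hv z Z hZ ↦ ?_⟩
  · simpa using (DeformedR.tendstoPoly_atInfinity hr hR u v).1 n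
  · simpa [Polynomial.aeval_def, Polynomial.eval_map] using
      (DeformedR.tendstoPoly_atInfinity hr hR u v).2 q
  · obtain ⟨w, rfl⟩ : ∃ w, v = DeformedR.simpleRefl b i * w :=
      ⟨DeformedR.simpleRefl b i * v, (DeformedR.simpleRefl_mul_cancel_left i v).symm⟩
    have hw := hv.length_lt
    rw [DeformedR.simpleRefl_mul_cancel_left] at hw
    -- For `v = s w`, `v⁻¹ α = w⁻¹ (s α) = -w⁻¹ α`.
    have hZ' : Z = z.pow (w⁻¹ • P.root i) := by
      rw [hZ, mul_inv_rev, DeformedR.simpleRefl_inv, mul_smul,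
        DeformedR.simpleRefl_smul_root_self, smul_neg, neg_neg]
    rw [DeformedR.simpleRefl_mul_cancel_left, hZ']
    exact ⟨fun hu ↦ hr.down hu.length_lt hw z, fun hu ↦ hr.up hu.length_lt hw z⟩
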